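/- Let $p\ge 3$ and $0<\theta<1/2$. Let $\mathcal D(\mathcal T^p,\theta)$ be the set of all probability distributions $Q$ on $\{0,1\}^p$ for which there is a tree $T_Q=(\{1,\dots,p\},\mathcal E_Q)$ (a connected acyclic graph) such that: (i) $Q$ is Markov on $T_Q$, i.e. $Q(x_i\mid x_{\{1,\dots,p\}\setminus\{i\}})=Q(x_i\mid x_{\mathrm{nbd}(i)})$ for every node $i$, where $\mathrm{nbd}(i)$ is the set of neighbours of $i$ in $T_Q$; (ii) all one-node marginals are uniform, $Q_i(0)=Q_i(1)=1/2$; (iii) $Q_{i,j}(0,1)=Q_{i,j}(1,0)=\theta/2$ for every edge $\{i,j\}\in\mathcal E_Q$. Let $P\in\mathcal D(\mathcal T^p,\theta)$ have tree $(\{1,\dots,p\},\mathcal E_P)$, and let $\mathbf x_1,\mathbf x_2,\dots$ be i.i.d. samples from $P$. For each $n$ let $P_{\mathrm{ML}}(\mathbf x^n)$ be a maximizer of $\sum_{k=1}^n\log Q(\mathbf x_k)$ over $Q\in\mathcal D(\mathcal T^p,\theta)$, with ties broken in an arbitrary (possibly random) way, and let $\mathcal E_{\mathrm{ML}}(\mathbf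 x^n)$ be the edge set of its tree. Then the error exponent of maximum likelihood structure learning exists and equals $$K_P:=\lim_{n\to\infty}-\frac1n\log\mathbb P\big(\mathcal E_{\mathrm{ML}}(\mathbf x^n)\neq\mathcal E_P\big)=-\log\Big(1-\theta\big(1-\sqrt{4\theta(1-\theta)}\big)\Big).$$ In particular, $K_P$ does not depend on $p$ or on the tree $\mathcal E_P$. -/

import Mathlib

open MeasureTheory ProbabilityTheory Filter Topology

namespace TreeLearning

/-- Local Markov property of a distribution `P` on `{0,1}^p` with respect to a graph `G`:
`P(x_i | x_{V \ i}) = P(x_i | x_{nbd(i)})` for all nodes `i` and all `x` for which the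
conditioning event on the left has positive probability. -/
def IsMarkov {p : ℕ} (G : SimpleGraph (Fin p)) (P : Measure (Fin p → Bool)) : Prop :=
  ∀ (i : Fin p) (x : Fin p → Bool),
    P {y | ∀ j, j ≠ i → y j = x j} ≠ 0 →
      P[{y | y i = x i} | {y | ∀ j, j ≠ i → y j = x j}] =
        P[{y | y i = x i} | {y | ∀ j, G.Adj i j → y j = x j}]

/-- `P` is a tree-structured graphical model on `{0,1}^p` with tree `T`, uniform marginals, and
`P_{i,j}(0,1) = P_{i,j}(1,0) = θ/2` on every edge `{i,j}` of `T`. -/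
structure IsTreeModel {p : ℕ} (θ : ℝ) (T : SimpleGraph (Fin p))
    (P : Measure (Fin p → Bool)) : Prop where
  isTree : T.IsTree
  isProbabilityMeasure : IsProbabilityMeasure P
  isMarkov : IsMarkov T P
  uniform : ∀ (i : Fin p) (b : Bool), P.real {x | x i = b} = 1 / 2
  homogeneous : ∀ i j : Fin p, T.Adj i j →
    P.real {x | x i = false ∧ x j = true} = θ / 2 ∧
      P.real {x | x i = true ∧ x j = false} = θ / 2

/-- The class of all tree models on `p` nodes with parameter `θ`. -/
def treeModels (p : ℕ) (θ : ℝ) : Set (Measure (Fin p → Bool)) :=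
  {P | ∃ T : SimpleGraph (Fin p), IsTreeModel θ T P}

/-- The log-likelihood of the samples `x` under `Q`. -/
noncomputable def logLikelihood {p n : ℕ} (x : Fin n → Fin p → Bool)
    (Q : Measure (Fin p → Bool)) : ℝ :=
  ∑ k, Real.log (Q.real {x k})

/-- `Q` is a maximum likelihood estimate, within the class of all tree models with
parameter `θ`, for the samples `x`. -/
def IsMLEstimate {p n : ℕ} (θ : ℝ) (x : Fin n → Fin p → Bool)
    (Q : Measure (Fin p → Bool)) : Prop :=
  Q ∈ treeModels p θ ∧ IsMaxOn (logLikelihood x) (treeModels p θ) Q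

end TreeLearning

/-! A model in the class is determined by its tree: its mass function is `1/2` times a product over
the edges of `θ` or `1 - θ`, according as the two ends differ or agree. The log-likelihood is
therefore a constant minus `log ((1 - θ) / θ) > 0` times the total number of disagreements along the
edges of the tree, and maximum likelihood selects a minimum spanning tree for the weights
`disagreements`.

Upper bound on the error. If the selected tree is wrong, it has an edge `{i, j}` outside `T`. The
path of `T` from `i` to `j` has length `L ≥ 2`, and one of its edges `{a, b}` can replace `{i, j}`
in the selected tree; minimality forces `{i, j}` to have at most as many disagreements as `{a, b}`.
For one sample, the difference of the two disagreements is `+1`, `-1`, `0` with probabilities `(1 -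
θ) Q`, `θ Q`, `1 - Q`, where `Q = (1 - (1 - 2θ)^(L-1)) / 2` is the probability of an odd number of
flips on the other edges of the path. Chernoff's bound gives `(1 - Q (1 - √(4θ(1 - θ))))^n`; as `Q ≥
θ`, with equality for `L = 2`, a union bound over finitely many configurations gives the rate `ρ = 1
- θ (1 - √(4θ(1 - θ)))`.

Lower bound. `T` contains a path `i, a, j`. If `{i, j}` has strictly fewer disagreements than `{i,
a}`, then `T` is not minimal and an error is certain however ties are broken. This probability is
bounded below by one coefficient of a power of a quadratic generating polynomial, at least a
constant times `ρ^n / n` (`le_coeff_pow_pred`).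

The product form comes from uniqueness, proved by peeling leaves (`markovOn_erase`), together with
existence (`isTreeModel_treeMeasure`). Existence is also what makes every spanning tree an
admissible competitor. -/

namespace TreeLearning

/-! ### Leaves and edge exchange in trees -/

section Graph

variable {V : Type*}

/-- In a tree, every nonempty finite set of vertices contains a vertex with at most one neighbour
in the set. -/
theorem exists_mem_subsingleton_neighbors {T : SimpleGraph V} (hT : T.IsTree) {S : Finset V}
    (hS : S.Nonempty) :
    ∃ l ∈ S, ∀ a ∈ S, ∀ b ∈ S, T.Adj l a → T.Adj l b → a = b := by
  classical
  obtain ⟨r⟩ := hT.connected.nonempty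
  -- Take `l` farthest from an arbitrary root: its neighbours in `S` are nearer to the root, and
  -- only the predecessor of `l` on the path from the root is.
  obtain ⟨l, hl, hmax⟩ := S.exists_max_image (T.dist r) hS
  obtain ⟨p, hp, -⟩ := (hT.connected r l).exists_path_of_dist
  have key : ∀ a ∈ S, T.Adj l a → a = p.penultimate := by
    intro a ha hla
    obtain ⟨q, hq, hqd⟩ := (hT.connected r a).exists_path_of_dist
    have hlt : T.dist r a < T.dist r l :=
      lt_of_le_of_ne (hmax a ha) (hT.dist_ne_of_adj r hla).symm
    have hnot : l ∉ q.support := by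
      intro h
      have h1 := SimpleGraph.dist_le (q.takeUntil l h)
      have h2 := q.length_takeUntil_le_length h
      omega
    exact hT.isAcyclic.eq_penultimate_of_adj_end hp hla
      (hT.isAcyclic.mem_support_of_ne_mem_support_of_adj_of_isPath hp hq hla hnot)
  exact ⟨l, hl, fun a ha b hb hla hlb => (key a ha hla).trans (key b hb hlb).symm⟩

/-- Removing an edge of a tree and reconnecting the two components by another edge gives a tree. -/
theorem isTree_exchange {T : SimpleGraph V} (hT : T.IsTree) {i j a b : V} (hij : T.Adj i j)
    (ha : (T.deleteEdges {s(i, j)}).Reachable i a) (hb : (T.deleteEdges {s(i, j)}).Reachable j b) :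
    (T.deleteEdges {s(i, j)} ⊔ SimpleGraph.edge a b).IsTree := by
  have hbridge : ¬ (T.deleteEdges {s(i, j)}).Reachable i j :=
    SimpleGraph.isBridge_iff.mp
      (SimpleGraph.isAcyclic_iff_forall_adj_isBridge.mp hT.isAcyclic hij)
  have hab : ¬ (T.deleteEdges {s(i, j)}).Reachable a b :=
    fun h => hbridge (ha.trans (h.trans hb.symm))
  have hne : a ≠ b := by rintro rfl; exact hab (SimpleGraph.Reachable.refl _)
  have hle : T.deleteEdges {s(i, j)} ≤ T.deleteEdges {s(i, j)} ⊔ SimpleGraph.edge a b := le_sup_left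
  have hadj : (T.deleteEdges {s(i, j)} ⊔ SimpleGraph.edge a b).Reachable i j := by
    refine (ha.mono hle).trans (SimpleGraph.Reachable.trans ?_ (hb.mono hle).symm)
    refine SimpleGraph.Adj.reachable ?_
    simp [SimpleGraph.edge_adj, hne]
  have := hT.connected.nonempty
  refine ⟨⟨fun u v => ?_⟩, (hT.isAcyclic.anti (T.deleteEdges_le _)).sup_edge_of_not_reachable hab⟩
  · obtain ⟨p⟩ := hT.connected u v
    induction p with
    | nil => exact SimpleGraph.Reachable.refl _
    | @cons x y z h _ ih =>
      refine SimpleGraph.Reachable.trans ?_ ih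
      by_cases hxy : s(x, y) = s(i, j)
      · rcases Sym2.eq_iff.mp hxy with ⟨rfl, rfl⟩ | ⟨rfl, rfl⟩
        · exact hadj
        · exact hadj.symm
      · refine SimpleGraph.Adj.reachable (hle ?_)
        simp [SimpleGraph.deleteEdges_adj, h, hxy]

/-- If `T'` is a tree with an edge `{i, j}` and `p` is a walk from `i` to `j`, some edge of `p` can
replace `{i, j}` in `T'`. -/
theorem exists_dart_isTree_exchange {T T' : SimpleGraph V} (hT' : T'.IsTree) {i j : V}
    (hij : T'.Adj i j) (p : T.Walk i j) :
    ∃ a b, s(a, b) ∈ p.edges ∧ (T'.deleteEdges {s(i, j)} ⊔ SimpleGraph.edge a b).IsTree := by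
  have hbridge : ¬ (T'.deleteEdges {s(i, j)}).Reachable i j :=
    SimpleGraph.isBridge_iff.mp
      (SimpleGraph.isAcyclic_iff_forall_adj_isBridge.mp hT'.isAcyclic hij)
  -- Deleting `{i, j}` separates `i` from `j`, so the walk must leave the component of `i`
  -- somewhere.
  obtain ⟨d, hd, ha, hb⟩ := p.exists_boundary_dart
    {v | (T'.deleteEdges {s(i, j)}).Reachable i v} (SimpleGraph.Reachable.refl _) hbridge
  refine ⟨d.fst, d.snd, List.mem_map.mpr ⟨d, hd, rfl⟩, isTree_exchange hT' hij ha ?_⟩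
  by_contra hb'
  -- Deleting one edge leaves only two components, so the far end of the crossing dart lies on the
  -- side of `j`.
  have key : ∀ x u, T'.Walk x u →
      (T'.deleteEdges {s(i, j)}).Reachable i x ∨ (T'.deleteEdges {s(i, j)}).Reachable j x →
      (T'.deleteEdges {s(i, j)}).Reachable i u ∨ (T'.deleteEdges {s(i, j)}).Reachable j u := by
    intro x u q
    induction q with
    | nil => exact id
    | @cons x y z h _ ih =>
      refine fun hx => ih ?_
      by_cases hxy : s(x, y) = s(i, j)
      · rcases Sym2.eq_iff.mp hxy with ⟨rfl, rfl⟩ | ⟨rfl, rfl⟩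
        · exact Or.inr (SimpleGraph.Reachable.refl _)
        · exact Or.inl (SimpleGraph.Reachable.refl _)
      · have hr : (T'.deleteEdges {s(i, j)}).Reachable x y :=
          SimpleGraph.Adj.reachable (by simp [SimpleGraph.deleteEdges_adj, h, hxy])
        exact hx.imp (fun h => h.trans hr) (fun h => h.trans hr)
  obtain ⟨q⟩ := hT'.connected i d.snd
  exact (key _ _ q (Or.inl (SimpleGraph.Reachable.refl _))).elim hb hb'

end Graph

/-! ### The product mass function and its characters -/

section Density

variable {V : Type*}

/-- Whether `x` takes different values at the two ends of `e`. -/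
def differ (x : V → Bool) (e : Sym2 V) : Bool :=
  Sym2.lift ⟨fun i j => xor (x i) (x j), fun _ _ => Bool.xor_comm _ _⟩ e

@[simp]
theorem differ_mk (x : V → Bool) (i j : V) : differ x s(i, j) = xor (x i) (x j) := rfl

/-- The mass function of a Bernoulli variable with parameter `θ`. -/
def bern (θ : ℝ) (b : Bool) : ℝ := if b then θ else 1 - θ

/-- The sign `(-1)^b`. -/
def sgn (b : Bool) : ℝ := if b then -1 else 1

theorem bern_pos {θ : ℝ} (h0 : 0 < θ) (h1 : θ < 1) (b : Bool) : 0 < bern θ b := by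
  cases b <;> simp [bern] <;> linarith

theorem sgn_xor (a b : Bool) : sgn (xor a b) = sgn a * sgn b := by
  cases a <;> cases b <;> simp [sgn]

theorem sgn_mul_sgn_eq_prod_edges {T : SimpleGraph V} (x : V → Bool) {i j : V} (p : T.Walk i j) :
    sgn (x i) * sgn (x j) = (p.edges.map fun e => sgn (differ x e)).prod := by
  induction p with
  | @nil u => cases h : x u <;> simp [sgn]
  | @cons a b c h p ih =>
    rw [SimpleGraph.Walk.edges_cons, List.map_cons, List.prod_cons, ← ih, differ_mk, sgn_xor]
    cases x b <;> simp [sgn]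

@[simp]
theorem differ_not (x : V → Bool) (e : Sym2 V) : differ (fun v => !x v) e = differ x e := by
  induction e with
  | _ i j => simp

variable [Fintype V]

open scoped Classical in
/-- The edges of a graph on a finite vertex set, as a finite set. -/
noncomputable def edges (T : SimpleGraph V) : Finset (Sym2 V) :=
  Finset.univ.filter (· ∈ T.edgeSet)

@[simp]
theorem mem_edges {T : SimpleGraph V} {e : Sym2 V} : e ∈ edges T ↔ e ∈ T.edgeSet := by
  simp [edges]

theorem card_edges_add_one {T : SimpleGraph V} (hT : T.IsTree) :
    (edges T).card + 1 = Fintype.card V := by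
  classical
  rw [← hT.card_edgeFinset]
  congr 2
  ext e
  simp

/-- The mass function of the tree model with tree `T`: uniform at one node, with independent flips
of probability `θ` along the edges. -/
noncomputable def density (θ : ℝ) (T : SimpleGraph V) (x : V → Bool) : ℝ :=
  1 / 2 * ∏ e ∈ edges T, bern θ (differ x e)

theorem density_pos {θ : ℝ} (h0 : 0 < θ) (h1 : θ < 1) (T : SimpleGraph V) (x : V → Bool) :
    0 < density θ T x :=
  mul_pos (by norm_num) (Finset.prod_pos fun _ _ => bern_pos h0 h1 _)

/-- A binary labelling of the vertices of a tree is determined by its value at a node and by the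
edges along which it changes, and these can be prescribed. -/
theorem bijective_root_differ {T : SimpleGraph V} (hT : T.IsTree) (r : V) :
    Function.Bijective
      (fun x : V → Bool => ((x r, fun e => differ x e) : Bool × (edges T → Bool))) := by
  classical
  rw [Fintype.bijective_iff_injective_and_card]
  constructor
  · intro x y hxy
    simp only [Prod.mk.injEq] at hxy
    obtain ⟨hr, he⟩ := hxy
    funext v
    obtain ⟨p⟩ := hT.connected v r
    induction p with
    | nil => exact hr
    | @cons a b c h _ ih =>
      have h1 := congrFun he ⟨s(a, b), by simpa using h⟩
      have h2 := ih hr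
      simp only [differ_mk, h2] at h1
      simpa using h1
  · simp only [Fintype.card_fun, Fintype.card_bool, Fintype.card_prod, Fintype.card_coe]
    rw [← card_edges_add_one hT, pow_succ, mul_comm]

/-- In the coordinates (root value, edge flips) the sum factorizes over the edges; the `2` counts
the root values. -/
theorem sum_prod_differ [DecidableEq V] {T : SimpleGraph V} (hT : T.IsTree) (g : Sym2 V → Bool → ℝ) :
    ∑ x : V → Bool, ∏ e ∈ edges T, g e (differ x e) =
      2 * ∏ e ∈ edges T, (g e true + g e false) := by
  classical
  obtain ⟨r⟩ := hT.connected.nonempty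
  have h := Function.Bijective.sum_comp (bijective_root_differ hT r)
    (fun z => ∏ e : edges T, g e (z.2 e))
  have h1 : ∀ x : V → Bool, ∏ e ∈ edges T, g e (differ x e) =
      ∏ e : edges T, g e (differ x e) := fun x =>
    (Finset.prod_coe_sort (edges T) (fun e => g e (differ x e))).symm
  rw [Finset.sum_congr rfl fun x _ => h1 x, h, Fintype.sum_prod_type]
  simp only [Finset.sum_const, Finset.card_univ, Fintype.card_bool, nsmul_eq_mul, Nat.cast_ofNat]
  rw [← Finset.prod_coe_sort (edges T) (fun e => g e true + g e false),
    ← Fintype.piFinset_univ]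
  rw [Finset.sum_prod_piFinset Finset.univ (fun e b => g (e : edges T) b)]
  simp

/-- The characters of the edge flips have mean `(1 - 2θ)^|F|`. -/
theorem sum_density_mul_prod_sgn [DecidableEq V] {T : SimpleGraph V} (hT : T.IsTree) (θ : ℝ)
    {F : Finset (Sym2 V)} (hF : F ⊆ edges T) :
    ∑ x : V → Bool, density θ T x * ∏ e ∈ F, sgn (differ x e) = (1 - 2 * θ) ^ F.card := by
  classical
  have h1 : ∀ x : V → Bool, density θ T x * ∏ e ∈ F, sgn (differ x e) =
      1 / 2 * ∏ e ∈ edges T,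
        (bern θ (differ x e) * if e ∈ F then sgn (differ x e) else 1) := by
    intro x
    rw [density, mul_assoc, Finset.prod_mul_distrib, Finset.prod_ite_mem,
      Finset.inter_eq_right.mpr hF]
  rw [Finset.sum_congr rfl fun x _ => h1 x, ← Finset.mul_sum,
    sum_prod_differ hT (fun e b => bern θ b * if e ∈ F then sgn b else 1)]
  have h2 : ∀ e ∈ edges T, ((bern θ true * if e ∈ F then sgn true else 1) +
      bern θ false * if e ∈ F then sgn false else 1) = if e ∈ F then 1 - 2 * θ else 1 := by
    intro e _
    split_ifs
    · simp [bern, sgn]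
      ring
    · simp [bern]
  rw [Finset.prod_congr rfl h2, Finset.prod_ite_mem, Finset.inter_eq_right.mpr hF]
  simp

theorem sum_density [DecidableEq V] {T : SimpleGraph V} (hT : T.IsTree) (θ : ℝ) :
    ∑ x : V → Bool, density θ T x = 1 := by
  simpa using sum_density_mul_prod_sgn hT θ (Finset.empty_subset _)

theorem density_not (θ : ℝ) (T : SimpleGraph V) (x : V → Bool) :
    density θ T (fun v => !x v) = density θ T x := by
  simp [density]

open scoped Classical in
/-- The part of the density that depends on the value at the node `i`. -/
noncomputable def nodeFactor (θ : ℝ) (T : SimpleGraph V) (i : V) (x : V → Bool) : ℝ :=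
  ∏ e ∈ edges T with i ∈ e, bern θ (differ x e)

theorem nodeFactor_pos {θ : ℝ} (h0 : 0 < θ) (h1 : θ < 1) (T : SimpleGraph V) (i : V)
    (x : V → Bool) : 0 < nodeFactor θ T i x :=
  Finset.prod_pos fun _ _ => bern_pos h0 h1 _

theorem nodeFactor_congr (θ : ℝ) {T : SimpleGraph V} {i : V} {x y : V → Bool} (hi : x i = y i)
    (h : ∀ j, T.Adj i j → x j = y j) : nodeFactor θ T i x = nodeFactor θ T i y := by
  classical
  refine Finset.prod_congr rfl fun e he => ?_
  simp only [Finset.mem_filter, mem_edges] at he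
  obtain ⟨he, j, rfl⟩ := he
  rw [differ_mk, differ_mk, hi, h j he]

/-- Edges avoiding `i` contribute equally to `x` and `y`, so the ratio of densities is the ratio of
node factors. -/
theorem density_mul_nodeFactor (θ : ℝ) (T : SimpleGraph V) (i : V) {x y : V → Bool}
    (h : ∀ j, j ≠ i → x j = y j) :
    density θ T x * nodeFactor θ T i y = density θ T y * nodeFactor θ T i x := by
  classical
  have hrest : ∏ e ∈ edges T with i ∉ e, bern θ (differ x e) =
      ∏ e ∈ edges T with i ∉ e, bern θ (differ y e) := by
    refine Finset.prod_congr rfl fun e he => ?_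
    induction e with
    | _ a b =>
      simp only [Finset.mem_filter, Sym2.mem_iff, not_or] at he
      rw [differ_mk, differ_mk, h a (Ne.symm he.2.1), h b (Ne.symm he.2.2)]
  unfold density
  rw [← Finset.prod_filter_mul_prod_filter_not (edges T) (i ∈ ·) (fun e => bern θ (differ x e)),
    ← Finset.prod_filter_mul_prod_filter_not (edges T) (i ∈ ·) (fun e => bern θ (differ y e)),
    hrest]
  unfold nodeFactor
  ring

end Density

/-! ### Marginals and the multiplied-out Markov property -/

section Cylinder

variable {p : ℕ}

/-- The probability that a sample from `P` agrees with `x` on `S`. -/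
noncomputable def cyl (P : Measure (Fin p → Bool)) (S : Finset (Fin p)) (x : Fin p → Bool) : ℝ :=
  P.real {y | ∀ j ∈ S, y j = x j}

open scoped Classical in
/-- The neighbours of `i` in `T` that belong to `S`. -/
noncomputable def nbhd (T : SimpleGraph (Fin p)) (S : Finset (Fin p)) (i : Fin p) :
    Finset (Fin p) :=
  S.filter (T.Adj i)

@[simp]
theorem mem_nbhd {T : SimpleGraph (Fin p)} {S : Finset (Fin p)} {i j : Fin p} :
    j ∈ nbhd T S i ↔ j ∈ S ∧ T.Adj i j := by
  simp [nbhd]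

/-- The local Markov property of the marginal of `P` on `S`, with the conditional probabilities
multiplied out. -/
def MarkovOn (T : SimpleGraph (Fin p)) (P : Measure (Fin p → Bool)) (S : Finset (Fin p)) : Prop :=
  ∀ i ∈ S, ∀ x, cyl P S x * cyl P (nbhd T S i) x =
    cyl P (S.erase i) x * cyl P (insert i (nbhd T S i)) x

theorem cyl_congr (P : Measure (Fin p → Bool)) {S : Finset (Fin p)} {x y : Fin p → Bool}
    (h : ∀ j ∈ S, x j = y j) : cyl P S x = cyl P S y := by
  unfold cyl
  congr 1
  ext z
  exact forall₂_congr fun j hj => by rw [h j hj]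

theorem cyl_update (P : Measure (Fin p → Bool)) {S : Finset (Fin p)} {l : Fin p} (hl : l ∉ S)
    (x : Fin p → Bool) (b : Bool) : cyl P S (Function.update x l b) = cyl P S x :=
  cyl_congr P fun j hj => by
    rw [Function.update_of_ne]
    rintro rfl
    exact hl hj

theorem cyl_eq_add (P : Measure (Fin p → Bool)) [IsFiniteMeasure P] {S : Finset (Fin p)}
    {l : Fin p} (hl : l ∉ S) (x : Fin p → Bool) :
    cyl P S x = cyl P (insert l S) (Function.update x l true) +
      cyl P (insert l S) (Function.update x l false) := by
  have h : ∀ b, {y : Fin p → Bool | ∀ j ∈ insert l S, y j = Function.update x l b j} =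
      {y | ∀ j ∈ S, y j = x j} ∩ {y | y l = b} := by
    intro b
    ext y
    simp only [Finset.mem_insert, forall_eq_or_imp, Function.update_self, Set.mem_ofPred_eq,
      Set.mem_inter_iff]
    rw [and_comm]
    refine and_congr_left fun _ => forall₂_congr fun j hj => ?_
    rw [Function.update_of_ne]
    rintro rfl
    exact hl hj
  unfold cyl
  rw [h, h, ← measureReal_inter_add_sdiff (s := {y : Fin p → Bool | ∀ j ∈ S, y j = x j})
    (MeasurableSet.of_discrete (s := {y : Fin p → Bool | y l = true}))]
  congr 2
  ext y
  simp

theorem cyl_singleton {θ : ℝ} {T : SimpleGraph (Fin p)} {P : Measure (Fin p → Bool)}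
    (hP : IsTreeModel θ T P) (l : Fin p) (x : Fin p → Bool) : cyl P {l} x = 1 / 2 := by
  simpa [cyl] using hP.uniform l (x l)

theorem cyl_empty (P : Measure (Fin p → Bool)) [IsProbabilityMeasure P] (x : Fin p → Bool) :
    cyl P ∅ x = 1 := by
  simp [cyl]

/-- Homogeneity gives the two off-diagonal values; subtracting them from the uniform marginal gives
the diagonal ones. -/
theorem cyl_pair {θ : ℝ} {T : SimpleGraph (Fin p)} {P : Measure (Fin p → Bool)}
    (hP : IsTreeModel θ T P) {l m : Fin p} (h : T.Adj l m) (x : Fin p → Bool) :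
    cyl P {l, m} x = bern θ (xor (x l) (x m)) / 2 := by
  have := hP.isProbabilityMeasure
  have hlm : l ∉ ({m} : Finset (Fin p)) := by simpa using h.ne
  have hne : ∀ y : Fin p → Bool, y l ≠ y m → cyl P {l, m} y = θ / 2 := by
    intro y hy
    have h2 := hP.homogeneous l m h
    cases hl : y l <;> cases hm : y m <;> simp [hl, hm] at hy
    · simpa [cyl, hl, hm] using h2.1
    · simpa [cyl, hl, hm] using h2.2
  by_cases hx : x l = x m
  · have h1 := cyl_eq_add P hlm x
    rw [cyl_singleton hP] at h1
    have hx' : Function.update x l (x l) = x := by simp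
    have h2 := hne (Function.update x l (!x l)) (by simp [Function.update_of_ne h.ne', hx])
    have h3 : bern θ (xor (x l) (x m)) = 1 - θ := by simp [hx, bern]
    rw [h3]
    cases hl : x l <;> rw [hl] at hx' h2 <;> simp only [Bool.not_false, Bool.not_true] at h2 <;>
      rw [hx', h2] at h1 <;> linarith
  · rw [hne x hx]
    have : xor (x l) (x m) = true := by simpa using hx
    simp [this, bern]

/-- Positivity of `P` is not known here. When the conditioning event is null both products vanish,
so the multiplied-out identity needs no exception. -/
theorem markovOn_univ {T : SimpleGraph (Fin p)} {P : Measure (Fin p → Bool)}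
    [IsProbabilityMeasure P] (h : IsMarkov T P) : MarkovOn T P Finset.univ := by
  intro i _ x
  have hA : {y : Fin p → Bool | ∀ j, j ≠ i → y j = x j} =
      {y | ∀ j ∈ Finset.univ.erase i, y j = x j} := by ext; simp
  have hB : {y : Fin p → Bool | ∀ j, T.Adj i j → y j = x j} =
      {y | ∀ j ∈ nbhd T Finset.univ i, y j = x j} := by ext; simp
  have hAE : {y : Fin p → Bool | ∀ j, j ≠ i → y j = x j} ∩ {y | y i = x i} =
      {y | ∀ j ∈ Finset.univ, y j = x j} := by
    ext y
    simp only [Set.mem_inter_iff, Set.mem_ofPred_eq, Finset.mem_univ, true_imp_iff]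
    refine ⟨fun h j => ?_, fun h => ⟨fun j _ => h j, h i⟩⟩
    by_cases hj : j = i
    · rw [hj, h.2]
    · exact h.1 j hj
  have hBE : {y : Fin p → Bool | ∀ j, T.Adj i j → y j = x j} ∩ {y | y i = x i} =
      {y | ∀ j ∈ insert i (nbhd T Finset.univ i), y j = x j} := by
    ext y
    simp [and_comm]
  by_cases h0 : P {y | ∀ j, j ≠ i → y j = x j} = 0
  · have h1 : cyl P (Finset.univ.erase i) x = 0 := by
      rw [cyl, ← hA, measureReal_def, h0, ENNReal.toReal_zero]
    have h2 : cyl P Finset.univ x = 0 := by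
      rw [cyl, ← hAE, measureReal_def, measure_mono_null Set.inter_subset_left h0,
        ENNReal.toReal_zero]
    rw [h1, h2, zero_mul, zero_mul]
  · have h1 := congrArg ENNReal.toReal (h i x h0)
    rw [cond_apply MeasurableSet.of_discrete, cond_apply MeasurableSet.of_discrete,
      ENNReal.toReal_mul, ENNReal.toReal_mul, ENNReal.toReal_inv, ENNReal.toReal_inv,
      hAE, hBE] at h1
    have hA0 : (P {y | ∀ j, j ≠ i → y j = x j}).toReal ≠ 0 :=
      ENNReal.toReal_ne_zero.mpr ⟨h0, measure_ne_top _ _⟩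
    have hB0 : (P {y | ∀ j, T.Adj i j → y j = x j}).toReal ≠ 0 := by
      refine ENNReal.toReal_ne_zero.mpr ⟨fun hz => h0 (measure_mono_null ?_ hz), measure_ne_top _ _⟩
      exact fun y hy j hj => hy j hj.ne'
    rw [inv_mul_eq_div, inv_mul_eq_div, div_eq_div_iff hA0 hB0] at h1
    simp only [cyl, measureReal_def, ← hA, ← hB]
    linarith

end Cylinder

/-! ### A tree determines its model: peeling leaves -/

section Uniqueness

variable {p : ℕ} {θ : ℝ} {T : SimpleGraph (Fin p)} {P : Measure (Fin p → Bool)}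

/-- The conditional probability of `x l` given that the neighbour of `l` in `S` (if there is one)
takes the value prescribed by `x`, when `l` has at most one neighbour in `S`. -/
noncomputable def leafFactor (θ : ℝ) (T : SimpleGraph (Fin p)) (S : Finset (Fin p)) (l : Fin p)
    (x : Fin p → Bool) : ℝ :=
  1 / 2 * ∏ m ∈ nbhd T S l, (2 * bern θ (xor (x l) (x m)))

theorem leafFactor_pos (h0 : 0 < θ) (h1 : θ < 1) (S : Finset (Fin p)) (l : Fin p)
    (x : Fin p → Bool) : 0 < leafFactor θ T S l x :=
  mul_pos (by norm_num) (Finset.prod_pos fun _ _ => mul_pos two_pos (bern_pos h0 h1 _))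

theorem leafFactor_update {S : Finset (Fin p)} {l k : Fin p} (hkl : k ≠ l) (hk : k ∉ nbhd T S l)
    (x : Fin p → Bool) (b : Bool) :
    leafFactor θ T S l (Function.update x k b) = leafFactor θ T S l x := by
  unfold leafFactor
  rw [Function.update_of_ne hkl.symm]
  congr 1
  refine Finset.prod_congr rfl fun m hm => ?_
  rw [Function.update_of_ne]
  rintro rfl
  exact hk hm

theorem cyl_eq_leafFactor_mul (hP : IsTreeModel θ T P) {S : Finset (Fin p)}
    (hM : MarkovOn T P S) {l : Fin p} (hl : l ∈ S)
    (huniq : ∀ a ∈ S, ∀ b ∈ S, T.Adj l a → T.Adj l b → a = b) (x : Fin p → Bool) :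
    cyl P S x = leafFactor θ T S l x * cyl P (S.erase l) x := by
  have := hP.isProbabilityMeasure
  have h := hM l hl x
  unfold leafFactor
  rcases (nbhd T S l).eq_empty_or_nonempty with hN | ⟨m, hm⟩
  · rw [hN, cyl_empty] at h
    rw [hN, Finset.prod_empty]
    have h2 := cyl_singleton hP l x
    simp only [insert_empty_eq] at h
    rw [h2] at h
    linarith
  · have hN : nbhd T S l = {m} := by
      refine Finset.eq_singleton_iff_unique_mem.mpr ⟨hm, fun k hk => ?_⟩
      simp only [mem_nbhd] at hm hk
      exact huniq k hk.1 m hm.1 hk.2 hm.2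
    rw [hN, cyl_singleton hP, cyl_pair hP (mem_nbhd.mp hm).2] at h
    rw [hN, Finset.prod_singleton]
    linarith

/-- The leaf factor involves only `l` and its neighbours in `S`, so every other vertex can be summed
out, one at a time, on both sides. -/
theorem cyl_insert_eq_leafFactor_mul [IsFiniteMeasure P] {S : Finset (Fin p)} {l : Fin p}
    (hl : l ∈ S)
    (hS : ∀ x, cyl P S x = leafFactor θ T S l x * cyl P (S.erase l) x) {B : Finset (Fin p)}
    (hB : B ⊆ S.erase l) (hN : nbhd T S l ⊆ B) (x : Fin p → Bool) :
    cyl P (insert l B) x = leafFactor θ T S l x * cyl P B x := by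
  suffices h : ∀ C : Finset (Fin p), C ⊆ S.erase l → Disjoint C (nbhd T S l) → ∀ x,
      cyl P (insert l (S.erase l \ C)) x = leafFactor θ T S l x * cyl P (S.erase l \ C) x by
    have h1 := h (S.erase l \ B) Finset.sdiff_subset
      (Finset.disjoint_of_subset_right hN Finset.sdiff_disjoint) x
    rwa [Finset.sdiff_sdiff_eq_self hB] at h1
  intro C
  induction C using Finset.induction_on with
  | empty =>
    intro _ _ x
    rw [Finset.sdiff_empty, Finset.insert_erase hl]
    exact hS x
  | insert k C hk ih =>
    intro hC hdisj x
    have hkS : k ∈ S.erase l := hC (Finset.mem_insert_self _ _)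
    have hkl : k ≠ l := Finset.ne_of_mem_erase hkS
    have hkN : k ∉ nbhd T S l := Finset.disjoint_left.mp hdisj (Finset.mem_insert_self _ _)
    have ih' := ih ((Finset.subset_insert _ _).trans hC)
      (Finset.disjoint_of_subset_left (Finset.subset_insert _ _) hdisj)
    have hk1 : k ∉ S.erase l \ insert k C := by simp
    have hk2 : k ∉ insert l (S.erase l \ insert k C) := by simp [hkl]
    have he : insert k (S.erase l \ insert k C) = S.erase l \ C := by
      ext j
      by_cases hj : j = k
      · subst hj; simp_all
      · simp [hj]
    rw [cyl_eq_add P hk1 x, cyl_eq_add P hk2 x, Finset.insert_comm, he, ih', ih',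
      leafFactor_update hkl hkN, leafFactor_update hkl hkN]
    ring

/-- Sum the Markov identity at `i` over the value at `l`. If `l` is not adjacent to `i`, two of the
four factors do not see `l` and the identity sums directly. If it is adjacent, `i` is the only
neighbour of `l` in `S`, and the positive leaf factor must be cancelled first. -/
theorem markovOn_erase (h0 : 0 < θ) (h1 : θ < 1) (hP : IsTreeModel θ T P) {S : Finset (Fin p)}
    (hM : MarkovOn T P S) {l : Fin p} (hl : l ∈ S)
    (huniq : ∀ a ∈ S, ∀ b ∈ S, T.Adj l a → T.Adj l b → a = b) :
    MarkovOn T P (S.erase l) := by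
  have := hP.isProbabilityMeasure
  have hS := cyl_eq_leafFactor_mul hP hM hl huniq
  intro i hi x
  have hil : i ≠ l := Finset.ne_of_mem_erase hi
  have hiS : i ∈ S := Finset.mem_of_mem_erase hi
  have hN' : nbhd T (S.erase l) i = (nbhd T S i).erase l := by
    ext j
    simp [and_assoc]
  have hlE : l ∉ (S.erase l).erase i := by simp
  have hiE : insert l ((S.erase l).erase i) = S.erase i := by
    rw [Finset.erase_right_comm, Finset.insert_erase]
    exact Finset.mem_erase.mpr ⟨hil.symm, hl⟩
  by_cases hadj : T.Adj i l
  · have hlN : l ∈ nbhd T S i := mem_nbhd.mpr ⟨hl, hadj⟩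
    have hNl : nbhd T S l = {i} := by
      refine Finset.eq_singleton_iff_unique_mem.mpr ⟨mem_nbhd.mpr ⟨hiS, hadj.symm⟩, fun k hk => ?_⟩
      exact huniq k (mem_nbhd.mp hk).1 i hiS (mem_nbhd.mp hk).2 hadj.symm
    have hBsub : insert i ((nbhd T S i).erase l) ⊆ S.erase l := by
      intro j hj
      rcases Finset.mem_insert.mp hj with rfl | hj
      · exact hi
      · rw [Finset.mem_erase, mem_nbhd] at hj
        exact Finset.mem_erase.mpr ⟨hj.1, hj.2.1⟩
    -- After cancellation, `l` occurs in only one factor on each side, so summing over its value is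
    -- linear.
    have key : ∀ y, cyl P (S.erase l) y * cyl P (nbhd T S i) y =
        cyl P (S.erase i) y * cyl P (insert i ((nbhd T S i).erase l)) y := by
      intro y
      have e1 := hM i hiS y
      have e2 := cyl_insert_eq_leafFactor_mul hl hS hBsub (by simp [hNl]) y
      rw [Finset.insert_comm, Finset.insert_erase hlN] at e2
      rw [hS, e2] at e1
      have := leafFactor_pos (T := T) h0 h1 S l y
      refine mul_left_cancel₀ this.ne' ?_
      linarith
    have hl1 : l ∉ S.erase l := by simp
    have hl2 : l ∉ (nbhd T S i).erase l := by simp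
    have hl3 : l ∉ insert i ((nbhd T S i).erase l) := by simp [hil.symm]
    rw [hN', cyl_eq_add P hl2 x, cyl_eq_add P hlE x, hiE, Finset.insert_erase hlN]
    have k1 := key (Function.update x l true)
    have k2 := key (Function.update x l false)
    rw [cyl_update P hl1, cyl_update P hl3] at k1 k2
    linarith
  · have hlN : l ∉ nbhd T S i := by simp [hadj]
    have hlN2 : l ∉ insert i (nbhd T S i) := by simp [hil.symm, hadj]
    have hl1 : l ∉ S.erase l := by simp
    rw [hN', Finset.erase_eq_of_notMem hlN, cyl_eq_add P hl1 x, cyl_eq_add P hlE x, hiE,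
      Finset.insert_erase hl]
    have k1 := hM i hiS (Function.update x l true)
    have k2 := hM i hiS (Function.update x l false)
    rw [cyl_update P hlN, cyl_update P hlN2] at k1 k2
    linarith

/-- A tree model is determined by its tree. -/
theorem IsTreeModel.cyl_eq {P' : Measure (Fin p → Bool)} (h0 : 0 < θ) (h1 : θ < 1)
    (hP : IsTreeModel θ T P) (hP' : IsTreeModel θ T P') (S : Finset (Fin p))
    (hM : MarkovOn T P S) (hM' : MarkovOn T P' S) (x : Fin p → Bool) :
    cyl P S x = cyl P' S x := by
  induction S using Finset.strongInduction with
  | H S ih =>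
    have := hP.isProbabilityMeasure
    have := hP'.isProbabilityMeasure
    rcases S.eq_empty_or_nonempty with rfl | hS
    · rw [cyl_empty, cyl_empty]
    · obtain ⟨l, hl, huniq⟩ := exists_mem_subsingleton_neighbors hP.isTree hS
      rw [cyl_eq_leafFactor_mul hP hM hl huniq, cyl_eq_leafFactor_mul hP' hM' hl huniq,
        ih _ (Finset.erase_ssubset hl) (markovOn_erase h0 h1 hP hM hl huniq)
          (markovOn_erase h0 h1 hP' hM' hl huniq)]

theorem IsTreeModel.real_singleton_eq {P' : Measure (Fin p → Bool)} (h0 : 0 < θ) (h1 : θ < 1)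
    (hP : IsTreeModel θ T P) (hP' : IsTreeModel θ T P') (x : Fin p → Bool) :
    P.real {x} = P'.real {x} := by
  have := hP.isProbabilityMeasure
  have := hP'.isProbabilityMeasure
  have h := hP.cyl_eq h0 h1 hP' Finset.univ (markovOn_univ hP.isMarkov)
    (markovOn_univ hP'.isMarkov) x
  have hx : {y : Fin p → Bool | ∀ j ∈ Finset.univ, y j = x j} = {x} := by
    ext y
    simp [funext_iff]
  rwa [cyl, cyl, hx] at h

end Uniqueness

/-! ### Every tree carries a model -/

section Existence

variable {p : ℕ}

theorem measureReal_eq_sum_ite (P : Measure (Fin p → Bool)) [IsFiniteMeasure P]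
    (φ : (Fin p → Bool) → Prop) [DecidablePred φ] :
    P.real {x | φ x} = ∑ x, if φ x then P.real {x} else 0 := by
  rw [← Finset.sum_filter, sum_measureReal_singleton]
  congr 1
  ext x
  simp

/-- The measure with mass function `density θ T`. -/
noncomputable def treeMeasure (θ : ℝ) (T : SimpleGraph (Fin p)) : Measure (Fin p → Bool) :=
  ∑ x, ENNReal.ofReal (density θ T x) • Measure.dirac x

theorem treeMeasure_singleton (θ : ℝ) (T : SimpleGraph (Fin p)) (x : Fin p → Bool) :
    treeMeasure θ T {x} = ENNReal.ofReal (density θ T x) := by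
  classical
  simp only [treeMeasure, Measure.coe_finsetSum, Measure.coe_smul, Finset.sum_apply, Pi.smul_apply,
    Measure.dirac_apply, smul_eq_mul]
  rw [Finset.sum_eq_single x]
  · simp
  · intro y _ hy
    simp [hy]
  · simp

variable {θ : ℝ} {T : SimpleGraph (Fin p)}

theorem isProbabilityMeasure_treeMeasure (h0 : 0 < θ) (h1 : θ < 1) (hT : T.IsTree) :
    IsProbabilityMeasure (treeMeasure θ T) := by
  constructor
  rw [treeMeasure]
  simp only [Measure.coe_finsetSum, Measure.coe_smul, Finset.sum_apply, Pi.smul_apply,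
    measure_univ, smul_eq_mul, mul_one]
  rw [← ENNReal.ofReal_sum_of_nonneg fun x _ => (density_pos h0 h1 T x).le, sum_density hT,
    ENNReal.ofReal_one]

theorem treeMeasure_real_singleton (h0 : 0 < θ) (h1 : θ < 1) (T : SimpleGraph (Fin p))
    (x : Fin p → Bool) : (treeMeasure θ T).real {x} = density θ T x := by
  rw [measureReal_def, treeMeasure_singleton, ENNReal.toReal_ofReal (density_pos h0 h1 T x).le]

/-- Global flip invariance of the tree measure. -/
theorem treeMeasure_real_not (h0 : 0 < θ) (h1 : θ < 1) (hT : T.IsTree)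
    (φ : (Fin p → Bool) → Prop) :
    (treeMeasure θ T).real {x | φ fun v => !x v} = (treeMeasure θ T).real {x | φ x} := by
  classical
  have := isProbabilityMeasure_treeMeasure h0 h1 hT
  rw [measureReal_eq_sum_ite, measureReal_eq_sum_ite]
  have hinv : Function.Involutive (fun (x : Fin p → Bool) v => !x v) := fun x => by simp
  rw [← hinv.bijective.sum_comp]
  refine Finset.sum_congr rfl fun x _ => ?_
  simp [treeMeasure_real_singleton h0 h1, density_not]

theorem treeMeasure_real_ne (h0 : 0 < θ) (h1 : θ < 1) (hT : T.IsTree) {i j : Fin p}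
    (hij : T.Adj i j) : (treeMeasure θ T).real {x | x i ≠ x j} = θ := by
  classical
  have := isProbabilityMeasure_treeMeasure h0 h1 hT
  have h := sum_density_mul_prod_sgn hT θ (F := {s(i, j)}) (by simpa using hij)
  have hs := sum_density hT θ
  simp only [Finset.prod_singleton, Finset.card_singleton, pow_one, differ_mk] at h
  rw [measureReal_eq_sum_ite]
  have key : ∀ x : Fin p → Bool, (if x i ≠ x j then (treeMeasure θ T).real {x} else 0) =
      1 / 2 * (density θ T x - density θ T x * sgn (xor (x i) (x j))) := by
    intro x
    rw [treeMeasure_real_singleton h0 h1]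
    cases x i <;> cases x j <;> simp [sgn]
    all_goals ring
  rw [Finset.sum_congr rfl fun x _ => key x, ← Finset.mul_sum, Finset.sum_sub_distrib, h, hs]
  ring

/-- The conditional probability of the value at `i` given an event that fixes the values at the
neighbours of `i` and does not depend on the value at `i`. -/
theorem treeMeasure_cond (h0 : 0 < θ) (h1 : θ < 1) (hT : T.IsTree) (i : Fin p) (x : Fin p → Bool)
    (C : Set (Fin p → Bool)) (hx : x ∈ C)
    (hC : ∀ y b, y ∈ C → Function.update y i b ∈ C)
    (hN : ∀ y ∈ C, ∀ j, T.Adj i j → y j = x j) :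
    (treeMeasure θ T)[{y | y i = x i} | C] = ENNReal.ofReal
      (nodeFactor θ T i x /
        (nodeFactor θ T i x + nodeFactor θ T i (Function.update x i (!x i)))) := by
  classical
  have := isProbabilityMeasure_treeMeasure h0 h1 hT
  set x' := Function.update x i (!x i) with hx'
  have hN0 := nodeFactor_pos h0 h1 T i x
  have hN1 := nodeFactor_pos h0 h1 T i x'
  have hC' : ∀ y b, Function.update y i b ∈ C ↔ y ∈ C := by
    refine fun y b => ⟨fun h => ?_, hC y b⟩
    have := hC _ (y i) h
    simpa using this
  -- Flipping the value at `i` exchanges the two parts of `C`. The weight ratio is the same at every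
  -- point, since `C` fixes the neighbours of `i`.
  have hflip : (treeMeasure θ T).real {y | y ∈ C ∧ ¬ y i = x i} * nodeFactor θ T i x =
      (treeMeasure θ T).real {y | y ∈ C ∧ y i = x i} * nodeFactor θ T i x' := by
    rw [measureReal_eq_sum_ite, measureReal_eq_sum_ite]
    have hinv : Function.Involutive
        (fun y : Fin p → Bool => Function.update y i (!y i)) := fun y => by simp
    rw [← hinv.bijective.sum_comp, Finset.sum_mul, Finset.sum_mul]
    refine Finset.sum_congr rfl fun y _ => ?_
    simp only [hC', Function.update_self, treeMeasure_real_singleton h0 h1]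
    have hb : ¬ (!y i) = x i ↔ y i = x i := by cases y i <;> cases x i <;> simp
    simp only [hb]
    split_ifs with h
    · have e1 : nodeFactor θ T i x = nodeFactor θ T i y :=
        nodeFactor_congr θ h.2.symm fun j hj => (hN y h.1 j hj).symm
      have e2 : nodeFactor θ T i x' = nodeFactor θ T i (Function.update y i (!y i)) := by
        refine nodeFactor_congr θ (by simp [hx', h.2]) fun j hj => ?_
        rw [hx', Function.update_of_ne hj.ne', Function.update_of_ne hj.ne', hN y h.1 j hj]
      rw [e1, e2]
      exact density_mul_nodeFactor θ T i fun j hj => Function.update_of_ne hj _ _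
    · simp
  have hsplit : (treeMeasure θ T).real C = (treeMeasure θ T).real {y | y ∈ C ∧ y i = x i} +
      (treeMeasure θ T).real {y | y ∈ C ∧ ¬ y i = x i} :=
    (measureReal_inter_add_sdiff (s := C)
      (MeasurableSet.of_discrete (s := {y : Fin p → Bool | y i = x i}))).symm
  have hpos : 0 < (treeMeasure θ T).real C := by
    refine lt_of_lt_of_le ?_ (measureReal_mono (Set.singleton_subset_iff.mpr hx))
    rw [treeMeasure_real_singleton h0 h1]
    exact density_pos h0 h1 T x
  rw [← ENNReal.ofReal_toReal (measure_ne_top _ _), cond_apply MeasurableSet.of_discrete,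
    ENNReal.toReal_mul, ENNReal.toReal_inv]
  change ENNReal.ofReal (((treeMeasure θ T).real C)⁻¹ *
    (treeMeasure θ T).real {y | y ∈ C ∧ y i = x i}) = _
  congr 1
  rw [inv_mul_eq_div, div_eq_div_iff hpos.ne' (by positivity)]
  rw [hsplit]
  linarith

theorem isTreeModel_treeMeasure (h0 : 0 < θ) (h1 : θ < 1) (hT : T.IsTree) :
    IsTreeModel θ T (treeMeasure θ T) := by
  have hprob := isProbabilityMeasure_treeMeasure h0 h1 hT
  refine ⟨hT, hprob, ?_, ?_, ?_⟩
  · intro i x _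
    rw [treeMeasure_cond h0 h1 hT i x {y | ∀ j, j ≠ i → y j = x j} (fun _ _ => rfl) ?_ ?_,
      treeMeasure_cond h0 h1 hT i x {y | ∀ j, T.Adj i j → y j = x j} (fun _ _ => rfl) ?_ ?_]
    · intro y b hy j hj
      rw [Function.update_of_ne hj.ne', hy j hj]
    · exact fun y hy => hy
    · intro y b hy j hj
      rw [Function.update_of_ne hj, hy j hj]
    · exact fun y hy j hj => hy j hj.ne'
  · intro i b
    have hflip := treeMeasure_real_not h0 h1 hT (fun x => x i = b)
    have hsum := measureReal_add_measureReal_compl (μ := treeMeasure θ T)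
      (MeasurableSet.of_discrete (s := {x : Fin p → Bool | x i = b}))
    have hcompl : {x : Fin p → Bool | x i = b}ᶜ = {x | (!x i) = b} := by
      ext x
      simp only [Set.mem_compl_iff, Set.mem_ofPred_eq]
      cases x i <;> cases b <;> simp
    rw [hcompl, hflip, probReal_univ] at hsum
    linarith
  · intro i j hij
    have hflip := treeMeasure_real_not h0 h1 hT (fun x => x i = true ∧ x j = false)
    simp only [Bool.not_eq_true', Bool.not_eq_false'] at hflip
    have hsum := treeMeasure_real_ne h0 h1 hT hij
    rw [← measureReal_inter_add_sdiff
      (MeasurableSet.of_discrete (s := {x : Fin p → Bool | x i = true}))] at hsum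
    have e1 : {x : Fin p → Bool | x i ≠ x j} ∩ {x | x i = true} =
        {x | x i = true ∧ x j = false} := by
      ext x
      simp only [Set.mem_inter_iff, Set.mem_ofPred_eq]
      cases x i <;> cases x j <;> simp
    have e2 : {x : Fin p → Bool | x i ≠ x j} \ {x | x i = true} =
        {x | x i = false ∧ x j = true} := by
      ext x
      simp only [Set.mem_sdiff, Set.mem_ofPred_eq]
      cases x i <;> cases x j <;> simp
    rw [e1, e2] at hsum
    constructor <;> linarith

theorem IsTreeModel.real_singleton {P : Measure (Fin p → Bool)} (h0 : 0 < θ) (h1 : θ < 1)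
    (hP : IsTreeModel θ T P) (x : Fin p → Bool) : P.real {x} = density θ T x := by
  rw [hP.real_singleton_eq h0 h1 (isTreeModel_treeMeasure h0 h1 hP.isTree),
    treeMeasure_real_singleton h0 h1]

end Existence

/-! ### Generating polynomials: Chernoff bound and central coefficients -/

section IIDSums

open Polynomial

variable {Ω : Type*} [MeasurableSpace Ω] {μ : Measure Ω} [IsProbabilityMeasure μ]

/-- The distribution of a sum of i.i.d. natural-valued variables with generating polynomial `q`. -/
theorem measureReal_sum_eq_coeff_pow {Y : ℕ → Ω → ℕ} (hm : ∀ k, AEMeasurable (Y k) μ)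
    (hY : iIndepFun Y μ) {q : ℝ[X]} (hq : ∀ k s, μ.real {ω | Y k ω = s} = q.coeff s) (n s : ℕ) :
    μ.real {ω | ∑ k ∈ Finset.range n, Y k ω = s} = (q ^ n).coeff s := by
  induction n generalizing s with
  | zero =>
    by_cases hs : s = 0
    · simp [hs]
    · simp [coeff_one, hs, Ne.symm hs]
  | succ n ih =>
    have hind : IndepFun (fun ω => ∑ k ∈ Finset.range n, Y k ω) (Y n) μ := by
      have := hY.indepFun_sum_range_succ₀ hm n
      convert this using 1
      ext ω
      simp
    have hms : AEMeasurable (fun ω => ∑ k ∈ Finset.range n, Y k ω) μ :=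
      Finset.aemeasurable_fun_sum _ fun k _ => hm k
    have hset : {ω | ∑ k ∈ Finset.range (n + 1), Y k ω = s} =
        ⋃ ab ∈ Finset.HasAntidiagonal.antidiagonal s,
          ((fun ω => ∑ k ∈ Finset.range n, Y k ω) ⁻¹' {ab.1} ∩ Y n ⁻¹' {ab.2}) := by
      ext ω
      simp only [Finset.sum_range_succ, Set.mem_ofPred_eq, Set.mem_iUnion, Finset.HasAntidiagonal.mem_antidiagonal,
        Set.mem_inter_iff, Set.mem_preimage, Set.mem_singleton_iff, exists_prop, Prod.exists]
      exact ⟨fun h => ⟨_, _, h, rfl, rfl⟩, by rintro ⟨a, b, h, rfl, rfl⟩; exact h⟩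
    rw [hset, measureReal_biUnion_finset₀, pow_succ, coeff_mul]
    · refine Finset.sum_congr rfl fun ab _ => ?_
      rw [measureReal_def, hind.measure_inter_preimage_eq_mul _ _ MeasurableSet.of_discrete
        MeasurableSet.of_discrete, ENNReal.toReal_mul]
      congr 1
      · exact ih ab.1
      · exact hq n ab.2
    · intro x _ y _ hxy
      refine Disjoint.aedisjoint (Set.disjoint_left.mpr fun ω h1 h2 => hxy ?_)
      exact Prod.ext (h1.1.symm.trans h2.1) (h1.2.symm.trans h2.2)
    · intro ab _
      exact (hms.nullMeasurableSet_preimage MeasurableSet.of_discrete).inter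
        ((hm n).nullMeasurableSet_preimage MeasurableSet.of_discrete)

/-- Chernoff's bound in terms of the generating polynomial. -/
theorem measureReal_sum_le_le_pow {Y : ℕ → Ω → ℕ} (hm : ∀ k, AEMeasurable (Y k) μ)
    (hY : iIndepFun Y μ) {q : ℝ[X]} (hq : ∀ k s, μ.real {ω | Y k ω = s} = q.coeff s)
    {t : ℝ} (ht0 : 0 < t) (ht1 : t ≤ 1) (n : ℕ) :
    μ.real {ω | ∑ k ∈ Finset.range n, Y k ω ≤ n} ≤ (q.eval t / t) ^ n := by
  have hcoeff := measureReal_sum_eq_coeff_pow hm hY hq n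
  have hnonneg : ∀ s, 0 ≤ (q ^ n).coeff s := fun s => by
    rw [← hcoeff s]
    exact measureReal_nonneg
  have hset : {ω | ∑ k ∈ Finset.range n, Y k ω ≤ n} =
      ⋃ s ∈ Finset.range (n + 1), {ω | ∑ k ∈ Finset.range n, Y k ω = s} := by
    ext ω
    simp
  have htn : 0 < t ^ n := pow_pos ht0 n
  calc μ.real {ω | ∑ k ∈ Finset.range n, Y k ω ≤ n}
      ≤ ∑ s ∈ Finset.range (n + 1), (q ^ n).coeff s := by
        rw [hset]
        refine (measureReal_biUnion_finset_le _ _).trans_eq ?_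
        exact Finset.sum_congr rfl fun s _ => hcoeff s
    -- `t ^ s / t ^ n ≥ 1` for `s ≤ n`, because `t ≤ 1`.
    _ ≤ ∑ s ∈ Finset.range (n + 1), (q ^ n).coeff s * t ^ s / t ^ n := by
        refine Finset.sum_le_sum fun s hs => ?_
        rw [le_div_iff₀ htn]
        refine mul_le_mul_of_nonneg_left ?_ (hnonneg s)
        exact pow_le_pow_of_le_one ht0.le ht1 (Nat.lt_succ_iff.mp (Finset.mem_range.mp hs))
    _ ≤ ∑ s ∈ Finset.range (max (n + 1) ((q ^ n).natDegree + 1)),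
          (q ^ n).coeff s * t ^ s / t ^ n := by
        refine Finset.sum_le_sum_of_subset_of_nonneg
          (Finset.range_subset_range.mpr (le_max_left _ _)) fun s _ _ => ?_
        exact div_nonneg (mul_nonneg (hnonneg s) (pow_nonneg ht0.le s)) htn.le
    _ = (q.eval t / t) ^ n := by
        rw [← Finset.sum_div, ← eval_eq_sum_range' (lt_of_lt_of_le (Nat.lt_succ_self _)
          (le_max_right _ _)), eval_pow, div_pow]

theorem reflect_pow_eq_self {q : ℝ[X]} {d : ℕ} (hd : q.natDegree ≤ d) (hq : reflect d q = q)
    (m : ℕ) : reflect (d * m) (q ^ m) = q ^ m := by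
  induction m with
  | zero => simp
  | succ m ih =>
    have hdm : (q ^ m).natDegree ≤ d * m := by
      rw [mul_comm]
      exact natDegree_pow_le_of_le m hd
    rw [pow_succ, Nat.mul_succ, reflect_mul _ _ hdm hd, ih, hq]

/-- The central coefficient of an even power of a palindromic quadratic polynomial. -/
theorem le_central_coeff_symm (a c : ℝ) (m : ℕ) :
    (c + 2 * a) ^ (2 * m) / (2 * m + 1) ≤
      ((C a + C c * X + C a * X ^ 2) ^ (2 * m) : ℝ[X]).coeff (2 * m) := by
  set q : ℝ[X] := C a + C c * X + C a * X ^ 2 with hqdef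
  have hd : q.natDegree ≤ 2 := by rw [hqdef]; compute_degree
  have hrefl : reflect 2 q = q := by
    ext k
    rw [coeff_reflect]
    by_cases hk : k ≤ 2
    · rw [revAt_le hk]
      interval_cases k <;> simp [hqdef, coeff_X, coeff_C, coeff_X_pow]
    · rw [revAt_eq_self_of_lt (by omega)]
  have hpal := reflect_pow_eq_self hd hrefl m
  have hdm : (q ^ m).natDegree < 2 * m + 1 := by
    have := natDegree_pow_le_of_le m hd
    omega
  have heval : ∑ i ∈ Finset.range (2 * m + 1), (q ^ m).coeff i = (c + 2 * a) ^ m := by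
    have h := eval_eq_sum_range' hdm (1 : ℝ)
    simp only [one_pow, mul_one] at h
    rw [← h, eval_pow, hqdef]
    simp
    ring
  -- Since `q ^ m` is palindromic, the central coefficient of its square is a sum of squares;
  -- Cauchy–Schwarz over the `2m + 1` terms then compares it with `q(1)^(2m)`.
  have hsq : (q ^ (2 * m)).coeff (2 * m) = ∑ i ∈ Finset.range (2 * m + 1), (q ^ m).coeff i ^ 2 := by
    rw [two_mul m, pow_add, coeff_mul, ← two_mul, Finset.Nat.sum_antidiagonal_eq_sum_range_succ
      (fun i j => (q ^ m).coeff i * (q ^ m).coeff j)]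
    refine Finset.sum_congr rfl fun i hi => ?_
    have hi' : i ≤ 2 * m := Nat.lt_succ_iff.mp (Finset.mem_range.mp hi)
    have := congrArg (fun f => f.coeff i) hpal
    simp only [coeff_reflect, revAt_le hi'] at this
    rw [this, sq]
  rw [hsq, div_le_iff₀ (by positivity)]
  have h := sq_sum_le_card_mul_sum_sq (s := Finset.range (2 * m + 1))
    (f := fun i => (q ^ m).coeff i)
  rw [heval, Finset.card_range, ← pow_mul] at h
  push_cast at h
  rw [mul_comm 2 m]
  rw [mul_comm 2 m] at h
  linarith

/-- The central coefficient of an even power of a quadratic polynomial. -/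
theorem le_central_coeff {v u : ℝ} (hv : 0 < v) (hu : 0 < u) (c : ℝ) (m : ℕ) :
    (c + 2 * √(u * v)) ^ (2 * m) / (2 * m + 1) ≤
      ((C v + C c * X + C u * X ^ 2) ^ (2 * m) : ℝ[X]).coeff (2 * m) := by
  refine (le_central_coeff_symm (√(u * v)) c m).trans_eq ?_
  -- Rescaling the variable by `t` makes the outer coefficients equal up to the common factor `t`,
  -- which reduces to the palindromic case.
  set t := √(u * v) / u with ht
  have huv : 0 < √(u * v) := Real.sqrt_pos.mpr (mul_pos hu hv)
  have hsq : √(u * v) * √(u * v) = u * v := Real.mul_self_sqrt (mul_pos hu hv).le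
  have ht0 : 0 < t := div_pos huv hu
  have hcomp : (C v + C c * X + C u * X ^ 2 : ℝ[X]).comp (C t * X) =
      C t * (C (√(u * v)) + C c * X + C (√(u * v)) * X ^ 2) := by
    have h1 : v = t * √(u * v) := by
      rw [ht, div_mul_eq_mul_div, hsq]
      field_simp
    have h2 : u * t ^ 2 = t * √(u * v) := by
      rw [ht]
      field_simp
    have h1' : (C v : ℝ[X]) = C t * C (√(u * v)) := by rw [← C_mul, ← h1]
    have h2' : (C u * C t ^ 2 : ℝ[X]) = C t * C (√(u * v)) := by
      rw [← C_pow, ← C_mul, ← C_mul, h2]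
    simp only [add_comp, mul_comp, C_comp, X_comp, pow_comp]
    linear_combination h1' + X ^ 2 * h2'
  have h := congrArg (fun f => (f ^ (2 * m)).coeff (2 * m)) hcomp
  simp only [← pow_comp, mul_pow, ← C_pow, coeff_C_mul, comp_C_mul_X_coeff] at h
  rw [mul_comm] at h
  exact (mul_left_cancel₀ (pow_pos ht0 _).ne' h).symm

theorem coeff_pow_nonneg {q : ℝ[X]} (hq : ∀ s, 0 ≤ q.coeff s) (n s : ℕ) :
    0 ≤ (q ^ n).coeff s := by
  induction n generalizing s with
  | zero =>
    rw [pow_zero, coeff_one]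
    split_ifs <;> norm_num
  | succ n ih =>
    rw [pow_succ, coeff_mul]
    exact Finset.sum_nonneg fun ab _ => mul_nonneg (ih _) (hq _)

theorem coeff_mul_coeff_le_coeff_mul {f g : ℝ[X]} (hf : ∀ s, 0 ≤ f.coeff s)
    (hg : ∀ s, 0 ≤ g.coeff s) (i j : ℕ) : f.coeff i * g.coeff j ≤ (f * g).coeff (i + j) := by
  rw [coeff_mul]
  exact Finset.single_le_sum (f := fun ab : ℕ × ℕ => f.coeff ab.1 * g.coeff ab.2)
    (fun ab _ => mul_nonneg (hf _) (hg _)) (Finset.HasAntidiagonal.mem_antidiagonal.mpr rfl : (i, j) ∈ _)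

/-- A lower bound, sharp on the exponential scale, for the coefficient just below the middle. -/
theorem le_coeff_pow_pred {v c u : ℝ} (hv : 0 < v) (hc : 0 < c) (hu : 0 < u) (hc1 : c ≤ 1)
    (hρ : c + 2 * √(u * v) ≤ 1) (n : ℕ) :
    v * c * ((c + 2 * √(u * v)) ^ (n + 1) / (n + 1)) ≤
      ((C v + C c * X + C u * X ^ 2) ^ (n + 1) : ℝ[X]).coeff n := by
  set q : ℝ[X] := C v + C c * X + C u * X ^ 2 with hqdef
  set ρ := c + 2 * √(u * v) with hρdef
  have hρ0 : 0 < ρ := by positivity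
  have hq0 : q.coeff 0 = v := by simp [hqdef]
  have hq1 : q.coeff 1 = c := by simp [hqdef, coeff_C, coeff_X_pow]
  have hnonneg : ∀ s, 0 ≤ q.coeff s := by
    intro s
    simp only [hqdef, coeff_add, coeff_C, coeff_C_mul, coeff_X, coeff_X_pow]
    split_ifs <;> positivity
  have hpow := coeff_pow_nonneg hnonneg
  have hstep0 : ∀ m s, (q ^ m).coeff s * v ≤ (q ^ (m + 1)).coeff s := by
    intro m s
    rw [pow_succ, ← hq0]
    exact coeff_mul_coeff_le_coeff_mul (hpow m) hnonneg s 0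
  have hstep1 : ∀ m s, (q ^ m).coeff s * c ≤ (q ^ (m + 1)).coeff (s + 1) := by
    intro m s
    rw [pow_succ, ← hq1]
    exact coeff_mul_coeff_le_coeff_mul (hpow m) hnonneg s 1
  have hdecr : ∀ m k : ℕ, 2 * m ≤ k → ρ ^ (k + 1) / ((k : ℝ) + 1) ≤
      (q ^ (2 * m)).coeff (2 * m) := by
    intro m k hk
    refine le_trans ?_ (le_central_coeff hv hu c m)
    have hk' : (2 * m + 1 : ℝ) ≤ k + 1 := by exact_mod_cast Nat.succ_le_succ hk
    exact div_le_div₀ (by positivity) (pow_le_pow_of_le_one hρ0.le hρ (by omega)) (by positivity) hk'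
  -- From the centre of an even power, a factor `v` raises the exponent alone and a factor `c`
  -- raises exponent and index together; one `v`, preceded by one `c` if `n` is odd, reaches
  -- coefficient `n` of power `n + 1`.
  rcases Nat.even_or_odd' n with ⟨m, rfl | rfl⟩
  · have h1 := hdecr m (2 * m) le_rfl
    have h2 := hstep0 (2 * m) (2 * m)
    have h3 : 0 ≤ ρ ^ (2 * m + 1) / (((2 * m : ℕ) : ℝ) + 1) := by positivity
    calc _ ≤ v * 1 * (ρ ^ (2 * m + 1) / (((2 * m : ℕ) : ℝ) + 1)) := by gcongr
      _ ≤ (q ^ (2 * m)).coeff (2 * m) * v := by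
        rw [mul_one, mul_comm]
        gcongr
      _ ≤ _ := h2
  · have h1 := hdecr m (2 * m + 1) (by omega)
    have h2 := hstep1 (2 * m) (2 * m)
    have h3 := hstep0 (2 * m + 1) (2 * m + 1)
    calc _ ≤ (q ^ (2 * m)).coeff (2 * m) * c * v := by
          rw [mul_comm, mul_comm v c, ← mul_assoc]
          gcongr
      _ ≤ (q ^ (2 * m + 1)).coeff (2 * m + 1) * v := by gcongr
      _ ≤ _ := h3

end IIDSums

/-! ### Maximum likelihood as a minimum spanning tree -/

section Likelihood

variable {p n : ℕ} {θ : ℝ}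

/-- The number of samples that differ at the two ends of `e`. -/
def disagreements (x : Fin n → Fin p → Bool) (e : Sym2 (Fin p)) : ℕ :=
  ∑ k, (differ (x k) e).toNat

theorem log_bern (θ : ℝ) (b : Bool) :
    Real.log (bern θ b) = Real.log (1 - θ) - b.toNat * (Real.log (1 - θ) - Real.log θ) := by
  cases b <;> simp [bern]

/-- All trees have `p - 1` edges, so only the total number of disagreements depends on the tree. -/
theorem logLikelihood_eq (h0 : 0 < θ) (h1 : θ < 1) {T : SimpleGraph (Fin p)}
    {Q : Measure (Fin p → Bool)} (hQ : IsTreeModel θ T Q) (x : Fin n → Fin p → Bool) :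
    logLikelihood x Q = n * (Real.log (1 / 2) + ((p : ℝ) - 1) * Real.log (1 - θ)) -
      (∑ e ∈ edges T, disagreements x e : ℕ) * (Real.log (1 - θ) - Real.log θ) := by
  have hcard : ((edges T).card : ℝ) = p - 1 := by
    have h := card_edges_add_one hQ.isTree
    rw [Fintype.card_fin] at h
    exact eq_sub_of_add_eq (by exact_mod_cast h)
  have h : ∀ k, Real.log (Q.real {x k}) = Real.log (1 / 2) + ((p : ℝ) - 1) * Real.log (1 - θ) -
      (∑ e ∈ edges T, ((differ (x k) e).toNat : ℝ)) * (Real.log (1 - θ) - Real.log θ) := by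
    intro k
    rw [hQ.real_singleton h0 h1, density, Real.log_mul (by norm_num)
      (Finset.prod_pos fun _ _ => bern_pos h0 h1 _).ne',
      Real.log_prod fun _ _ => (bern_pos h0 h1 _).ne',
      Finset.sum_congr rfl fun e _ => log_bern θ _, Finset.sum_sub_distrib, Finset.sum_const,
      nsmul_eq_mul, hcard, ← Finset.sum_mul]
    ring
  unfold logLikelihood disagreements
  rw [Finset.sum_congr rfl fun k _ => h k, Finset.sum_sub_distrib, Finset.sum_const,
    ← Finset.sum_mul, Finset.sum_comm, Finset.card_univ, Fintype.card_fin, nsmul_eq_mul]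
  push_cast
  rfl

/-- The tree of a maximum likelihood estimate minimizes the number of disagreements. -/
theorem IsMLEstimate.sum_disagreements_le (h0 : 0 < θ) (h1 : θ < 1 / 2)
    {x : Fin n → Fin p → Bool} {Q : Measure (Fin p → Bool)} (hML : IsMLEstimate θ x Q)
    {T T' : SimpleGraph (Fin p)} (hQ : IsTreeModel θ T Q) (hT' : T'.IsTree) :
    ∑ e ∈ edges T, disagreements x e ≤ ∑ e ∈ edges T', disagreements x e := by
  have h1' : θ < 1 := by linarith
  have hQ' := isTreeModel_treeMeasure h0 h1' hT'
  have h : logLikelihood x (treeMeasure θ T') ≤ logLikelihood x Q := hML.2 ⟨T', hQ'⟩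
  rw [logLikelihood_eq h0 h1' hQ, logLikelihood_eq h0 h1' hQ'] at h
  have hlog : 0 < Real.log (1 - θ) - Real.log θ :=
    sub_pos.mpr (Real.log_lt_log h0 (by linarith))
  have h2 : ((∑ e ∈ edges T, disagreements x e : ℕ) : ℝ) ≤
      (∑ e ∈ edges T', disagreements x e : ℕ) :=
    le_of_mul_le_mul_right (by linarith) hlog
  exact_mod_cast h2

theorem IsMLEstimate.disagreements_le (h0 : 0 < θ) (h1 : θ < 1 / 2)
    {x : Fin n → Fin p → Bool} {Q : Measure (Fin p → Bool)} (hML : IsMLEstimate θ x Q)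
    {T : SimpleGraph (Fin p)} (hQ : IsTreeModel θ T Q) {i j a b : Fin p} (hij : T.Adj i j)
    (hT' : (T.deleteEdges {s(i, j)} ⊔ SimpleGraph.edge a b).IsTree) :
    disagreements x s(i, j) ≤ disagreements x s(a, b) := by
  have h := hML.sum_disagreements_le h0 h1 hQ hT'
  have hsub : edges (T.deleteEdges {s(i, j)} ⊔ SimpleGraph.edge a b) ⊆
      insert s(a, b) ((edges T).erase s(i, j)) := by
    intro e he
    simp only [mem_edges, SimpleGraph.edgeSet_sup, SimpleGraph.edgeSet_deleteEdges,
      Set.mem_union, Set.mem_sdiff, Set.mem_singleton_iff] at he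
    simp only [Finset.mem_insert, Finset.mem_erase, mem_edges]
    rcases he with he | he
    · exact Or.inr ⟨he.2, he.1⟩
    · left
      induction e with
      | _ c d =>
        rw [SimpleGraph.mem_edgeSet, SimpleGraph.edge_adj] at he
        simpa [Sym2.eq_iff, eq_comm, and_comm] using he.1
  have h2 := Finset.sum_le_sum_of_subset (f := disagreements x) hsub
  have h3 : ∑ e ∈ insert s(a, b) ((edges T).erase s(i, j)), disagreements x e ≤
      disagreements x s(a, b) + ∑ e ∈ (edges T).erase s(i, j), disagreements x e := by
    by_cases hmem : s(a, b) ∈ (edges T).erase s(i, j)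
    · rw [Finset.insert_eq_of_mem hmem]
      exact Nat.le_add_left _ _
    · rw [Finset.sum_insert hmem]
  have h4 := Finset.add_sum_erase (edges T) (disagreements x) (a := s(i, j)) (by simpa using hij)
  omega

end Likelihood

/-! ### Joint law of a path and one of its edges -/

section PairLaw

variable {p : ℕ} {θ : ℝ} {T : SimpleGraph (Fin p)} {P : Measure (Fin p → Bool)}

/-- The joint law of the disagreements of the ends of a path and of the ends of one of its
edges. -/
theorem IsTreeModel.real_path_edge (h0 : 0 < θ) (h1 : θ < 1) (hP : IsTreeModel θ T P)
    {i j a b : Fin p} (w : T.Walk i j) (hw : w.IsPath) (hab : s(a, b) ∈ w.edges) :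
    P.real {x | x i ≠ x j ∧ x a = x b} = (1 - θ) * ((1 - (1 - 2 * θ) ^ (w.length - 1)) / 2) ∧
      P.real {x | x i = x j ∧ x a ≠ x b} = θ * ((1 - (1 - 2 * θ) ^ (w.length - 1)) / 2) := by
  classical
  have := hP.isProbabilityMeasure
  set F := w.edges.toFinset with hFdef
  have habF : s(a, b) ∈ F := by simpa [hFdef] using hab
  have hF : F ⊆ edges T := fun e he => by
    rw [mem_edges]
    exact w.edges_subset_edgeSet (by simpa [hFdef] using he)
  have hnodup : w.edges.Nodup := hw.isTrail.edges_nodup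
  have hcard : F.card = w.length := by
    rw [hFdef, List.toFinset_card_of_nodup hnodup, SimpleGraph.Walk.length_edges]
  have hlen : 0 < w.length := by
    rw [← hcard]
    exact Finset.card_pos.mpr ⟨_, habF⟩
  have hχ : ∀ x : Fin p → Bool, ∏ e ∈ F, sgn (differ x e) = sgn (x i) * sgn (x j) := by
    intro x
    rw [sgn_mul_sgn_eq_prod_edges x w, hFdef, List.prod_toFinset _ hnodup]
  have hσ : ∀ x : Fin p → Bool, ∏ e ∈ F.erase s(a, b), sgn (differ x e) =
      sgn (x i) * sgn (x j) * (sgn (x a) * sgn (x b)) := by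
    intro x
    rw [← hχ, ← Finset.mul_prod_erase F _ habF, differ_mk, sgn_xor]
    cases x a <;> cases x b <;> simp [sgn]
  have s0 := sum_density hP.isTree θ
  have s1 := sum_density_mul_prod_sgn hP.isTree θ hF
  have s2 := sum_density_mul_prod_sgn hP.isTree θ ((F.erase_subset s(a, b)).trans hF)
  have s3 := sum_density_mul_prod_sgn hP.isTree θ (F := {s(a, b)})
    (Finset.singleton_subset_iff.mpr (hF habF))
  simp only [hχ] at s1
  simp only [hσ] at s2
  simp only [Finset.prod_singleton, differ_mk, sgn_xor, Finset.card_singleton, pow_one] at s3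
  rw [Finset.card_erase_of_mem habF, hcard] at s2
  rw [hcard] at s1
  have hpow : (1 - 2 * θ) ^ w.length = (1 - 2 * θ) ^ (w.length - 1) * (1 - 2 * θ) := by
    rw [← pow_succ, Nat.sub_add_cancel hlen]
  rw [hpow] at s1
  rw [measureReal_eq_sum_ite, measureReal_eq_sum_ite]
  constructor
  · have key : ∀ x : Fin p → Bool, (if x i ≠ x j ∧ x a = x b then P.real {x} else 0) =
        1 / 4 * (density θ T x - density θ T x * (sgn (x i) * sgn (x j)) +
          density θ T x * (sgn (x a) * sgn (x b)) -
          density θ T x * (sgn (x i) * sgn (x j) * (sgn (x a) * sgn (x b)))) := by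
      intro x
      rw [hP.real_singleton h0 h1]
      cases x i <;> cases x j <;> cases x a <;> cases x b <;> simp [sgn] <;> ring
    rw [Finset.sum_congr rfl fun x _ => key x, ← Finset.mul_sum, Finset.sum_sub_distrib,
      Finset.sum_add_distrib, Finset.sum_sub_distrib, s0, s1, s2, s3]
    ring
  · have key : ∀ x : Fin p → Bool, (if x i = x j ∧ x a ≠ x b then P.real {x} else 0) =
        1 / 4 * (density θ T x + density θ T x * (sgn (x i) * sgn (x j)) -
          density θ T x * (sgn (x a) * sgn (x b)) -
          density θ T x * (sgn (x i) * sgn (x j) * (sgn (x a) * sgn (x b)))) := by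
      intro x
      rw [hP.real_singleton h0 h1]
      cases x i <;> cases x j <;> cases x a <;> cases x b <;> simp [sgn] <;> ring
    rw [Finset.sum_congr rfl fun x _ => key x, ← Finset.mul_sum, Finset.sum_sub_distrib,
      Finset.sum_sub_distrib, Finset.sum_add_distrib, s0, s1, s2, s3]
    ring

/-- One plus the difference of the disagreements of `x` at `{i, j}` and at `{a, b}`. -/
def step (i j a b : Fin p) (x : Fin p → Bool) : ℕ :=
  1 + (differ x s(i, j)).toNat - (differ x s(a, b)).toNat

/-- The shift by one keeps the truncated subtraction exact. -/
theorem step_add (i j a b : Fin p) (x : Fin p → Bool) :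
    step i j a b x + (differ x s(a, b)).toNat = 1 + (differ x s(i, j)).toNat := by
  unfold step
  have := Bool.toNat_le (differ x s(a, b))
  omega

open Polynomial in
/-- The generating polynomial of `step`, when the ends `i`, `j` of a path of which `{a, b}` is an
edge differ with probability `Q` modulo the disagreement at `{a, b}`. -/
noncomputable def stepPoly (θ Q : ℝ) : ℝ[X] :=
  C (θ * Q) + C (1 - Q) * X + C ((1 - θ) * Q) * X ^ 2

theorem IsTreeModel.real_step (h0 : 0 < θ) (h1 : θ < 1) (hP : IsTreeModel θ T P)
    {i j a b : Fin p} (w : T.Walk i j) (hw : w.IsPath) (hab : s(a, b) ∈ w.edges) (s : ℕ) :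
    P.real {x | step i j a b x = s} =
      (stepPoly θ ((1 - (1 - 2 * θ) ^ (w.length - 1)) / 2)).coeff s := by
  have := hP.isProbabilityMeasure
  obtain ⟨hu, hv⟩ := hP.real_path_edge h0 h1 w hw hab
  set Q := (1 - (1 - 2 * θ) ^ (w.length - 1)) / 2
  have e2 : {x : Fin p → Bool | step i j a b x = 2} = {x | x i ≠ x j ∧ x a = x b} := by
    ext x
    simp only [step, differ_mk, Set.mem_ofPred_eq]
    cases x i <;> cases x j <;> cases x a <;> cases x b <;> simp
  have e0 : {x : Fin p → Bool | step i j a b x = 0} = {x | x i = x j ∧ x a ≠ x b} := by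
    ext x
    simp only [step, differ_mk, Set.mem_ofPred_eq]
    cases x i <;> cases x j <;> cases x a <;> cases x b <;> simp
  have hle : ∀ x, step i j a b x ≤ 2 := by
    intro x
    have := Bool.toNat_le (differ x s(i, j))
    unfold step
    omega
  have hsum : P.real {x | step i j a b x = 0} + P.real {x | step i j a b x = 1} +
      P.real {x | step i j a b x = 2} = 1 := by
    rw [measureReal_eq_sum_ite, measureReal_eq_sum_ite, measureReal_eq_sum_ite,
      ← Finset.sum_add_distrib, ← Finset.sum_add_distrib, ← probReal_univ (μ := P),
      ← Finset.coe_univ, ← sum_measureReal_singleton]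
    refine Finset.sum_congr rfl fun x _ => ?_
    have := hle x
    interval_cases step i j a b x <;> simp
  rw [e0, e2, hu, hv] at hsum
  unfold stepPoly
  by_cases hs : s ≤ 2
  · interval_cases s
    · rw [e0, hv]
      simp
    · simp only [Polynomial.coeff_add, Polynomial.coeff_C, Polynomial.coeff_C_mul,
        Polynomial.coeff_X, Polynomial.coeff_X_pow]
      norm_num
      linarith
    · rw [e2, hu]
      simp only [Polynomial.coeff_add, Polynomial.coeff_C, Polynomial.coeff_C_mul,
        Polynomial.coeff_X, Polynomial.coeff_X_pow]
      norm_num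
  · have : {x : Fin p → Bool | step i j a b x = s} = ∅ := by
      ext x
      have := hle x
      simp
      omega
    rw [this, measureReal_empty]
    simp only [Polynomial.coeff_add, Polynomial.coeff_C, Polynomial.coeff_C_mul,
      Polynomial.coeff_X, Polynomial.coeff_X_pow]
    rw [if_neg (by omega), if_neg (by omega), if_neg (by omega)]
    simp

end PairLaw

/-! ### Matching exponential bounds -/

section Exponent

variable {p : ℕ} {θ : ℝ} {T : SimpleGraph (Fin p)} {P : Measure (Fin p → Bool)}
  {Ω : Type*} [MeasurableSpace Ω] {μ : Measure Ω}
  {X : ℕ → Ω → Fin p → Bool}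

theorem measureReal_of_hasLaw {Y : Ω → Fin p → Bool} (h : HasLaw Y P μ) (A : Set (Fin p → Bool)) :
    μ.real {ω | Y ω ∈ A} = P.real A := by
  rw [measureReal_def, measureReal_def, ← h.map_eq,
    Measure.map_apply_of_aemeasurable h.aemeasurable MeasurableSet.of_discrete]
  rfl

theorem sum_step_add (x : ℕ → Fin p → Bool) (i j a b : Fin p) (n : ℕ) :
    ∑ k ∈ Finset.range n, step i j a b (x k) + disagreements (fun k : Fin n => x k) s(a, b) =
      n + disagreements (fun k : Fin n => x k) s(i, j) := by
  unfold disagreements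
  rw [Finset.sum_range, ← Finset.sum_add_distrib, Finset.sum_congr rfl fun k _ => step_add i j a b _,
    Finset.sum_add_distrib]
  simp

theorem measureReal_step (h0 : 0 < θ) (h1 : θ < 1) (hP : IsTreeModel θ T P)
    (hXlaw : ∀ k, HasLaw (X k) P μ) {i j a b : Fin p} (w : T.Walk i j)
    (hw : w.IsPath) (hab : s(a, b) ∈ w.edges) (k s : ℕ) :
    μ.real {ω | step i j a b (X k ω) = s} =
      (stepPoly θ ((1 - (1 - 2 * θ) ^ (w.length - 1)) / 2)).coeff s := by
  rw [← hP.real_step h0 h1 w hw hab]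
  exact measureReal_of_hasLaw (hXlaw k) {x | step i j a b x = s}

theorem aemeasurable_step (hXlaw : ∀ k, HasLaw (X k) P μ) (i j a b : Fin p) (k : ℕ) :
    AEMeasurable (fun ω => step i j a b (X k ω)) μ :=
  (Measurable.of_discrete (f := step i j a b)).comp_aemeasurable (hXlaw k).aemeasurable

theorem iIndepFun_step (hXindep : iIndepFun X μ) (i j a b : Fin p) :
    iIndepFun (fun k ω => step i j a b (X k ω)) μ :=
  hXindep.comp (fun _ => step i j a b) fun _ => Measurable.of_discrete

theorem sqrt_four_mul (θ : ℝ) : √(4 * θ * (1 - θ)) = 2 * √(θ * (1 - θ)) := by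
  rw [mul_assoc, Real.sqrt_mul (by norm_num), show (4 : ℝ) = 2 ^ 2 by norm_num,
    Real.sqrt_sq (by norm_num)]

theorem two_mul_sqrt_le_one (θ : ℝ) : 2 * √(θ * (1 - θ)) ≤ 1 := by
  rw [← sqrt_four_mul, Real.sqrt_le_iff]
  refine ⟨zero_le_one, ?_⟩
  nlinarith [sq_nonneg (2 * θ - 1)]

variable [IsProbabilityMeasure μ]

theorem measureReal_disagreements_le (h0 : 0 < θ) (h1 : θ < 1 / 2) (hP : IsTreeModel θ T P)
    (hXlaw : ∀ k, HasLaw (X k) P μ) (hXindep : iIndepFun X μ) {i j a b : Fin p} (w : T.Walk i j)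
    (hw : w.IsPath) (hlen : 2 ≤ w.length) (hab : s(a, b) ∈ w.edges) (n : ℕ) :
    μ.real {ω | disagreements (fun k : Fin n => X k ω) s(i, j) ≤
      disagreements (fun k : Fin n => X k ω) s(a, b)} ≤
        (1 - θ * (1 - √(4 * θ * (1 - θ)))) ^ n := by
  have h1' : θ < 1 := by linarith
  have hset : {ω | disagreements (fun k : Fin n => X k ω) s(i, j) ≤
      disagreements (fun k : Fin n => X k ω) s(a, b)} =
      {ω | ∑ k ∈ Finset.range n, step i j a b (X k ω) ≤ n} := by
    ext ω
    have := sum_step_add (fun k => X k ω) i j a b n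
    simp only [Set.mem_ofPred_eq]
    omega
  set Q := (1 - (1 - 2 * θ) ^ (w.length - 1)) / 2 with hQdef
  set r := √(θ * (1 - θ)) with hr
  have hθ : 0 < θ * (1 - θ) := mul_pos h0 (by linarith)
  have hr0 : 0 < r := Real.sqrt_pos.mpr hθ
  have hr2 : r * r = θ * (1 - θ) := Real.mul_self_sqrt hθ.le
  have hr1 : 2 * r ≤ 1 := two_mul_sqrt_le_one θ
  have hQ : θ ≤ Q := by
    have : (1 - 2 * θ) ^ (w.length - 1) ≤ (1 - 2 * θ) ^ 1 :=
      pow_le_pow_of_le_one (by linarith) (by linarith) (by omega)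
    rw [hQdef]
    linarith
  have hQ1 : Q ≤ 1 := by
    have : 0 ≤ (1 - 2 * θ) ^ (w.length - 1) := pow_nonneg (by linarith) _
    rw [hQdef]
    linarith
  -- `r / (1 - θ) = √(θ / (1 - θ))` minimizes the Chernoff bound for every `Q`; it is at most `1`
  -- since `r ≤ 1/2 ≤ 1 - θ`.
  have ht0 : 0 < r / (1 - θ) := div_pos hr0 (by linarith)
  have ht1 : r / (1 - θ) ≤ 1 := by
    rw [div_le_one (by linarith)]
    linarith
  rw [hset]
  refine (measureReal_sum_le_le_pow (aemeasurable_step hXlaw i j a b)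
    (iIndepFun_step hXindep i j a b) (measureReal_step h0 h1' hP hXlaw w hw hab)
    ht0 ht1 n).trans ?_
  have heval : (stepPoly θ Q).eval (r / (1 - θ)) / (r / (1 - θ)) = 1 - Q * (1 - 2 * r) := by
    have hne : (1 - θ) ≠ 0 := by linarith
    simp only [stepPoly, Polynomial.eval_add, Polynomial.eval_mul, Polynomial.eval_C,
      Polynomial.eval_X, Polynomial.eval_pow]
    field_simp
    linear_combination (-Q) * hr2
  rw [← hQdef, heval, sqrt_four_mul, ← hr]
  refine pow_le_pow_left₀ ?_ ?_ n
  · nlinarith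
  · have := mul_le_mul_of_nonneg_right hQ (by linarith : 0 ≤ 1 - 2 * r)
    linarith

theorem le_measureReal_disagreements_lt (h0 : 0 < θ) (h1 : θ < 1 / 2) (hP : IsTreeModel θ T P)
    (hXlaw : ∀ k, HasLaw (X k) P μ) (hXindep : iIndepFun X μ) {i a j : Fin p} (hia : T.Adj i a)
    (haj : T.Adj a j) (hij : i ≠ j) (n : ℕ) :
    θ * θ * (1 - θ) * ((1 - θ * (1 - √(4 * θ * (1 - θ)))) ^ (n + 1) / (n + 1)) ≤
      μ.real {ω | disagreements (fun k : Fin (n + 1) => X k ω) s(i, j) <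
        disagreements (fun k : Fin (n + 1) => X k ω) s(i, a)} := by
  have h1' : θ < 1 := by linarith
  let w : T.Walk i j := .cons hia (.cons haj .nil)
  have hw : w.IsPath := by
    simp [w, SimpleGraph.Walk.cons_isPath_iff, hia.ne, haj.ne, hij]
  have hwl : w.length = 2 := rfl
  have hab : s(i, a) ∈ w.edges := by simp [w]
  have hq := measureReal_step h0 h1' hP hXlaw w hw hab
  have hQ : (1 - (1 - 2 * θ) ^ (w.length - 1)) / 2 = θ := by
    rw [hwl]
    ring
  rw [hQ] at hq
  -- With `n + 1` samples, a sum of steps equal to `n` means a deficit of exactly one: the strict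
  -- inequality that rules out ties.
  have hcoeff := measureReal_sum_eq_coeff_pow (aemeasurable_step hXlaw i j i a)
    (iIndepFun_step hXindep i j i a) hq (n + 1) n
  have hsub : {ω | ∑ k ∈ Finset.range (n + 1), step i j i a (X k ω) = n} ⊆
      {ω | disagreements (fun k : Fin (n + 1) => X k ω) s(i, j) <
        disagreements (fun k : Fin (n + 1) => X k ω) s(i, a)} := by
    intro ω hω
    have := sum_step_add (fun k => X k ω) i j i a (n + 1)
    simp only [Set.mem_ofPred_eq] at hω ⊢
    omega
  refine le_trans ?_ (measureReal_mono hsub)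
  rw [hcoeff]
  have hsqrt : √((1 - θ) * θ * (θ * θ)) = θ * √(θ * (1 - θ)) := by
    rw [show (1 - θ) * θ * (θ * θ) = θ ^ 2 * (θ * (1 - θ)) by ring,
      Real.sqrt_mul (sq_nonneg _), Real.sqrt_sq h0.le]
  have hρ : (1 - θ) + 2 * √((1 - θ) * θ * (θ * θ)) = 1 - θ * (1 - √(4 * θ * (1 - θ))) := by
    rw [hsqrt, sqrt_four_mul]
    ring
  have hmain := le_coeff_pow_pred (v := θ * θ) (c := 1 - θ) (u := (1 - θ) * θ)
    (mul_pos h0 h0) (by linarith) (mul_pos (by linarith) h0) (by linarith) (by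
      rw [hsqrt]
      nlinarith [two_mul_sqrt_le_one θ]) n
  rw [hρ] at hmain
  exact hmain

/-- A tree on at least three vertices has a vertex with two neighbours. -/
theorem exists_path_length_two (hp : 2 < p) (hT : T.IsTree) :
    ∃ i a j, T.Adj i a ∧ T.Adj a j ∧ i ≠ j := by
  have hne : (⟨0, by omega⟩ : Fin p) ≠ ⟨1, by omega⟩ := by simp
  have : Nontrivial (Fin p) := ⟨_, _, hne⟩
  obtain ⟨a, ha⟩ := hT.connected.preconnected.exists_adj_of_nontrivial ⟨0, by omega⟩
  set o : Fin p := ⟨0, by omega⟩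
  obtain ⟨z, hz⟩ : ∃ z, z ∉ ({o, a} : Finset (Fin p)) := by
    by_contra! h
    have h1 : Finset.univ ⊆ ({o, a} : Finset (Fin p)) := fun z _ => h z
    have h2 := Finset.card_le_card h1
    have h3 := Finset.card_le_two (a := o) (b := a)
    rw [Finset.card_univ, Fintype.card_fin] at h2
    omega
  obtain ⟨w⟩ := hT.connected o z
  obtain ⟨d, -, hd1, hd2⟩ := w.exists_boundary_dart (({o, a} : Finset (Fin p)) : Set (Fin p))
    (by simp) (by simpa using hz)
  simp only [Finset.coe_insert, Finset.coe_singleton, Set.mem_insert_iff, Set.mem_singleton_iff,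
    not_or] at hd1 hd2
  rcases hd1 with h | h
  · exact ⟨a, o, d.snd, ha.symm, h ▸ d.adj, Ne.symm hd2.2⟩
  · exact ⟨o, a, d.snd, ha, h ▸ d.adj, Ne.symm hd2.1⟩

/-- Trees on the same vertices have equally many edges, so inclusion would force equality. -/
theorem exists_adj_not_adj {T' : SimpleGraph (Fin p)} (hT : T.IsTree) (hT' : T'.IsTree)
    (hne : T'.edgeSet ≠ T.edgeSet) : ∃ i j, T'.Adj i j ∧ ¬ T.Adj i j := by
  by_contra! h
  have hsub : edges T' ⊆ edges T := by
    intro e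
    induction e with
    | _ i j => simpa using h i j
  have hc := card_edges_add_one hT
  have hc' := card_edges_add_one hT'
  have heq := Finset.eq_of_subset_of_card_le hsub (by omega)
  refine hne (Set.ext fun e => ?_)
  rw [← mem_edges, ← mem_edges, heq]

/-- A sequence squeezed between two constant multiples of `ρ ^ n`, up to a factor `1 / n`, has
exponential rate `-log ρ`. -/
theorem tendsto_neg_log_div {f : ℕ → ℝ} {ρ K M : ℝ} (hρ : 0 < ρ) (hK : 0 < K) (hM : 0 < M)
    (hlow : ∀ n : ℕ, 0 < n → K * (ρ ^ n / n) ≤ f n) (hup : ∀ n : ℕ, 0 < n → f n ≤ M * ρ ^ n) :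
    Tendsto (fun n : ℕ => -(1 / (n : ℝ)) * Real.log (f n)) atTop (𝓝 (-Real.log ρ)) := by
  have hinv : Tendsto (fun n : ℕ => 1 / (n : ℝ)) atTop (𝓝 0) := tendsto_one_div_atTop_nhds_zero_nat
  have hlog : Tendsto (fun n : ℕ => Real.log n / (n : ℝ)) atTop (𝓝 0) :=
    (Real.isLittleO_log_id_atTop.tendsto_div_nhds_zero).comp tendsto_natCast_atTop_atTop
  have hl : Tendsto (fun n : ℕ => -(1 / (n : ℝ) * Real.log M) - Real.log ρ) atTop
      (𝓝 (-Real.log ρ)) := by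
    simpa using ((hinv.mul_const (Real.log M)).neg).sub_const (Real.log ρ)
  have hu : Tendsto (fun n : ℕ => -(1 / (n : ℝ) * Real.log K) + Real.log n / n - Real.log ρ) atTop
      (𝓝 (-Real.log ρ)) := by
    simpa using (((hinv.mul_const (Real.log K)).neg).add hlog).sub_const (Real.log ρ)
  refine tendsto_of_tendsto_of_tendsto_of_le_of_le' hl hu ?_ ?_
  · filter_upwards [eventually_gt_atTop 0] with n hn
    have hn' : (0 : ℝ) < n := by exact_mod_cast hn
    have hf : 0 < f n := lt_of_lt_of_le (by positivity) (hlow n hn)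
    have h := Real.log_le_log hf (hup n hn)
    rw [Real.log_mul hM.ne' (pow_pos hρ n).ne', Real.log_pow] at h
    have h2 := mul_le_mul_of_nonneg_left h (one_div_pos.mpr hn').le
    have h3 : 1 / (n : ℝ) * (Real.log M + n * Real.log ρ) =
        1 / (n : ℝ) * Real.log M + Real.log ρ := by
      field_simp
    linarith
  · filter_upwards [eventually_gt_atTop 0] with n hn
    have hn' : (0 : ℝ) < n := by exact_mod_cast hn
    have h := Real.log_le_log (by positivity) (hlow n hn)
    rw [Real.log_mul hK.ne' (by positivity), Real.log_div (pow_pos hρ n).ne' hn'.ne',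
      Real.log_pow] at h
    have h2 := mul_le_mul_of_nonneg_left h (one_div_pos.mpr hn').le
    have h3 : 1 / (n : ℝ) * (Real.log K + (n * Real.log ρ - Real.log n)) =
        1 / (n : ℝ) * Real.log K + Real.log ρ - Real.log n / n := by
      field_simp
      ring
    linarith

theorem measureReal_mono_ae {A B : Set Ω} (h : ∀ᵐ ω ∂μ, ω ∈ A → ω ∈ B) : μ.real A ≤ μ.real B :=
  ENNReal.toReal_mono (measure_ne_top μ B) (measure_mono_ae h)

end Exponent

end TreeLearning

/-! ### The error exponent -/

open TreeLearning in
/-- `X 0, X 1, …` are i.i.d. samples from the tree model `P` with tree `T`; for every `n`, `PML n`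
is a maximum likelihood estimate based on the first `n` samples (ties broken in any way, possibly
at random) and `TML n` is its tree. -/
theorem mainTheorem3 {p : ℕ} (hp : 2 < p) {θ : ℝ} (hθ0 : 0 < θ) (hθ1 : θ < 1 / 2)
    {T : SimpleGraph (Fin p)} {P : Measure (Fin p → Bool)}
    (hP : TreeLearning.IsTreeModel θ T P)
    {Ω : Type*} [MeasurableSpace Ω] {μ : Measure Ω} [IsProbabilityMeasure μ]
    {X : ℕ → Ω → Fin p → Bool}
    (hXlaw : ∀ k, HasLaw (X k) P μ) (hXindep : iIndepFun X μ)
    {PML : ℕ → Ω → Measure (Fin p → Bool)} {TML : ℕ → Ω → SimpleGraph (Fin p)}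
    (hPML : ∀ n, ∀ᵐ ω ∂μ,
      TreeLearning.IsMLEstimate θ (fun k : Fin n => X k ω) (PML n ω))
    (hTML : ∀ n, ∀ᵐ ω ∂μ, TreeLearning.IsTreeModel θ (TML n ω) (PML n ω)) :
    Tendsto
      (fun n : ℕ => -(1 / (n : ℝ)) * Real.log (μ.real {ω | (TML n ω).edgeSet ≠ T.edgeSet}))
      atTop (𝓝 (-Real.log (1 - θ * (1 - √(4 * θ * (1 - θ)))))) := by
  classical
  have hρ : 0 < 1 - θ * (1 - √(4 * θ * (1 - θ))) := by
    have := Real.sqrt_nonneg (4 * θ * (1 - θ))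
    nlinarith
  -- The configurations in the union bound; their number is independent of `n`, hence invisible to
  -- the exponent.
  let G : Finset ((Fin p × Fin p) × (Fin p × Fin p)) := Finset.univ.filter fun t =>
    ∃ w : T.Walk t.1.1 t.1.2, w.IsPath ∧ 2 ≤ w.length ∧ s(t.2.1, t.2.2) ∈ w.edges
  refine tendsto_neg_log_div (K := θ * θ * (1 - θ)) (M := (G.card : ℝ) + 1) hρ
    (mul_pos (mul_pos hθ0 hθ0) (by linarith)) (by positivity) ?_ ?_
  · intro n hn
    obtain ⟨m, rfl⟩ := Nat.exists_eq_succ_of_ne_zero hn.ne'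
    obtain ⟨i, a, j, hia, haj, hij⟩ := exists_path_length_two hp hP.isTree
    have h := le_measureReal_disagreements_lt hθ0 hθ1 hP hXlaw hXindep hia haj hij m
    rw [Nat.succ_eq_add_one, Nat.cast_add_one]
    refine h.trans (measureReal_mono_ae ?_)
    filter_upwards [hPML (m + 1), hTML (m + 1)] with ω hML hT' hlt heq
    -- If the selected tree were `T`, exchanging `{i, a}` for `{i, j}` would contradict minimality.
    have hTeq : TML (m + 1) ω = T := SimpleGraph.edgeSet_injective heq
    rw [hTeq] at hT'
    have hreach : (T.deleteEdges {s(i, a)}).Reachable a j :=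
      SimpleGraph.Adj.reachable (by
        simp [SimpleGraph.deleteEdges_adj, haj, hia.ne', hij.symm])
    have := hML.disagreements_le hθ0 hθ1 hT' hia
      (isTree_exchange hP.isTree hia (SimpleGraph.Reachable.refl _) hreach)
    exact absurd hlt (not_lt.mpr this)
  · intro n _
    have hsub : ∀ᵐ ω ∂μ, ω ∈ {ω | (TML n ω).edgeSet ≠ T.edgeSet} →
        ω ∈ ⋃ t ∈ G, {ω | disagreements (fun k : Fin n => X k ω) s(t.1.1, t.1.2) ≤
          disagreements (fun k : Fin n => X k ω) s(t.2.1, t.2.2)} := by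
      filter_upwards [hPML n, hTML n] with ω hML hT' hne
      obtain ⟨i, j, hij, hnij⟩ := exists_adj_not_adj hP.isTree hT'.isTree hne
      obtain ⟨w, hw⟩ := hP.isTree.connected.exists_isPath i j
      obtain ⟨a, b, hab, htree⟩ := exists_dart_isTree_exchange hT'.isTree hij w
      have hlen : 2 ≤ w.length := by
        by_contra! hlt
        interval_cases hl : w.length
        · exact hij.ne (SimpleGraph.Walk.eq_of_length_eq_zero hl)
        · exact hnij (SimpleGraph.Walk.adj_of_length_eq_one hl)
      refine Set.mem_biUnion (x := ((i, j), (a, b))) ?_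
        (hML.disagreements_le hθ0 hθ1 hT' hij htree)
      simp only [G, Finset.coe_filter, Finset.mem_univ, true_and]
      exact ⟨w, hw, hlen, hab⟩
    refine (measureReal_mono_ae hsub).trans ((measureReal_biUnion_finset_le _ _).trans ?_)
    have hterm : ∀ t ∈ G, μ.real {ω | disagreements (fun k : Fin n => X k ω) s(t.1.1, t.1.2) ≤
        disagreements (fun k : Fin n => X k ω) s(t.2.1, t.2.2)} ≤
        (1 - θ * (1 - √(4 * θ * (1 - θ)))) ^ n := by
      intro t ht
      obtain ⟨w, hw, hlen, hab⟩ := (Finset.mem_filter.mp ht).2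
      exact measureReal_disagreements_le hθ0 hθ1 hP hXlaw hXindep w hw hlen hab n
    refine (Finset.sum_le_card_nsmul _ _ _ hterm).trans ?_
    rw [nsmul_eq_mul]
    exact mul_le_mul_of_nonneg_right (by linarith) (pow_pos hρ n).le
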